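/- Let $T$ be a compact metric space, $\mathbb{C}_0$ the space of non-negative, non-null continuous functions on $T$ with the sup norm and its Borel $\sigma$-algebra, and $\mu$ a Borel measure on $\mathbb{C}_0$. Let $M_p(\mathbb{C}_0)$ be the set of countable sums $M$ of Dirac masses at points of $\mathbb{C}_0$ having finitely many atoms (with multiplicity) in $\{\|f\|>\varepsilon\}$ for every $\varepsilon>0$, with the $\sigma$-algebra generated by the maps $M\mapsto M(A)$, $A$ Borel. Let $\Phi$ be a Poisson random measure with intensity $\mu$ and values in $M_p(\mathbb{C}_0)$, on a probability space, and let $\eta=\max(\Phi)$, i.e. $\eta(t)=\max\{f(t): f \text{ an atom of } \Phi\}$ (and $\eta\equiv 0$ if $\Phi=0$), which is the sample continuous max-i.d. process with vertex function $0$ and exponent measure $\mu$. Let $\mathbf t=(t_1,\dots,t_k)\in T^k$, $K=\{t_1,\dots,t_k\}$, and assume (A): for every $t\in K$ the tail function $\bar\mu_t(x)=\mu\{f: f(t)\ge x\}$ is continuous on $(0,\infty)$ and $\bar\mu_t(0^+)=+\infty$. For $t\in K$, the $t$-extremal function $\phi^+_t$ is the atom of $\Phi$ with $\phi_t^+(t)=\eta(t)$,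 when there is exactly one (counted with multiplicity). The hitting scenario $\Theta$ is the random partition of $K$ into the classes of the relation $t\sim t'\iff\phi_t^+=\phi_{t'}^+$ (the points $t$ where $\phi_t^+$ is undefined, if any, form one class). For $\mathbf s=(s_1,\dots,s_l)\in T^l$ put $f(\mathbf s)=(f(s_1),\dots,f(s_l))$; let $\mu_{\mathbf s}$ be the measure $\mu_{\mathbf s}(A)=\mu\{f: f(\mathbf s)\in A\}$ on $[0,\infty)^l\setminus\{0\}$, and $\bar\mu_{\mathbf s}(\mathbf x)=\mu\{f: f(\mathbf s)\not<\mathbf x\}$, where $<$ between vectors means $<$ in every coordinate. A regular version of $\mu(df)$ given $f(\mathbf s)=\mathbf x$ is a probability kernel $P_{\mathbf s}(\mathbf x,df)$, $\mathbf x\in[0,\infty)^l\setminus\{0\}$, from $[0,\infty)^l\setminus\{0\}$ to $\mathbb{C}_0$ such that $$\int_{\mathbb{C}_0}F(f(\mathbf s),f)\,\mu(df)=\int_{[0,\infty)^l\setminus\{0\}}\int_{\mathbb{C}_0}F(\mathbf x,f)\,P_{\mathbf s}(\mathbf x,df)\,\mu_{\mathbf s}(d\mathbf x)$$ for all measurable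 $F\ge0$ vanishing on $\{0\}\times\mathbb{C}_0$. For $L\subset K$ write $\mathbf t_L=(t_i)_{i:\,t_i\in L}$, $\mathbf y_L=(y_i)_{i:\,t_i\in L}$ and $L^c=K\setminus L$. Theorem. The vector $\eta(\mathbf t)$ and the events $\{\Theta=\tau\}$ are measurable, almost surely $\phi_t^+$ is defined for all $t\in K$, and regular versions $P_{\mathbf t_L}$ exist for all $L\subset K$. For every partition $\tau=\{\tau_1,\dots,\tau_\ell\}$ of $K$ and every choice of regular versions $P_{\mathbf t_{\tau_j}}$, the measure $\nu^\tau_{\mathbf t}(C)=\mathbb{P}(\eta(\mathbf t)\in C,\ \Theta=\tau)$ on $[0,\infty)^k$ is $$\nu^\tau_{\mathbf t}(d\mathbf y)=\exp[-\bar\mu_{\mathbf t}(\mathbf y)]\bigotimes_{j=1}^{\ell}\Big\{P_{\mathbf t_{\tau_j}}\big(\mathbf y_{\tau_j},\{f(\mathbf t_{\tau_j^c})<\mathbf y_{\tau_j^c}\}\big)\,\mu_{\mathbf t_{\tau_j}}(d\mathbf y_{\tau_j})\Big\},$$ that is, the measure whose density with respect to the product measure $\bigotimes_j\mu_{\mathbf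 t_{\tau_j}}(d\mathbf y_{\tau_j})$ is $\exp[-\bar\mu_{\mathbf t}(\mathbf y)]\prod_{j}P_{\mathbf t_{\tau_j}}(\mathbf y_{\tau_j},\{f(\mathbf t_{\tau_j^c})<\mathbf y_{\tau_j^c}\})$, with $\exp(-\infty)=0$. Moreover the law $\nu_{\mathbf t}$ of $\eta(\mathbf t)$ is $\nu_{\mathbf t}=\sum_{\tau}\nu_{\mathbf t}^\tau$, the sum being over all partitions $\tau$ of $K$. -/

import Mathlib

open MeasureTheory ProbabilityTheory Set Filter Topology
open scoped ENNReal NNReal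

noncomputable section

namespace MaxID

section Space

variable (T : Type*) [TopologicalSpace T] [CompactSpace T]

/-- The space `ℂ₀` of non-negative, non-null continuous functions on `T`, with the topology of
uniform convergence. -/
def C0 : Type _ := {f : C(T, ℝ) // (∀ t, 0 ≤ f t) ∧ f ≠ 0}

instance : TopologicalSpace (C0 T) := instTopologicalSpaceSubtype

/-- `ℂ₀` carries its Borel `σ`-algebra. -/
instance : MeasurableSpace (C0 T) := borel (C0 T)

instance : BorelSpace (C0 T) := ⟨rfl⟩

instance : CoeFun (C0 T) (fun _ => T → ℝ) := ⟨fun f => f.1⟩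

end Space

variable {T : Type*} [MetricSpace T] [CompactSpace T]

/-- A measure on `ℂ₀` is a point measure in `M_p(ℂ₀)` if it is a countable sum of Dirac masses
(with multiplicities allowed), finitely many of which sit in `{‖f‖ > ε}`, for every `ε > 0`. -/
def IsPointMeasure (M : Measure (C0 T)) : Prop :=
  ∃ (ι : Type) (_ : Countable ι) (f : ι → C0 T),
    M = Measure.sum (fun i => Measure.dirac (f i)) ∧
      ∀ ε : ℝ, 0 < ε → {i | ε < ‖(f i).1‖}.Finite

variable (T) in
/-- The space `M_p(ℂ₀)` of point measures. -/
def PointMeasure : Type _ := {M : Measure (C0 T) // IsPointMeasure M}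

/-- The `σ`-algebra on `M_p(ℂ₀)`, generated by the maps `M ↦ M(A)`, `A` Borel. -/
instance : MeasurableSpace (PointMeasure T) := Subtype.instMeasurableSpace

/-- The set `[M]` of atoms of a measure. -/
def atoms (M : Measure (C0 T)) : Set (C0 T) := {f | M {f} ≠ 0}

/-- The function `max(M)`, `t ↦ max {f(t); f ∈ [M]}`. For point measures the set is bounded (and
the supremum is attained); it is `0` for the null measure. -/
def maxFun (M : Measure (C0 T)) (t : T) : ℝ := sSup {x | ∃ f ∈ atoms M, x = f t}

/-- `f <_K g` : pointwise strict inequality on `K`. -/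
def LtOn (K : Set T) (f g : T → ℝ) : Prop := ∀ t ∈ K, f t < g t

/-- The `K`-extremal part `M_K⁺` of a point measure `M`: its restriction to the functions `f` with
`f ≮_K max(M)`. -/
def extremalPart (K : Set T) (M : Measure (C0 T)) : Measure (C0 T) :=
  M.restrict {f | ¬ LtOn K f (maxFun M)}

open Classical in
/-- The `t`-extremal function `φ_t⁺`, i.e. the function with `M_{t}⁺ = δ_{φ_t⁺}`; it is `none` if
`M_{t}⁺` is not a Dirac mass. -/
def extremalFun (M : Measure (C0 T)) (t : T) : Option (C0 T) :=
  if h : ∃ f : C0 T, extremalPart {t} M = Measure.dirac f then some h.choose else none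

open Classical in
/-- The hitting scenario: the partition of `K` into the classes of the equivalence relation
`φ_t⁺ = φ_{t'}⁺`. -/
def hittingScenario [DecidableEq T] (K : Finset T) (M : Measure (C0 T)) : Finpartition K :=
  Finpartition.ofSetSetoid (Setoid.ker (extremalFun M)) K

/-- `Φ` is a Poisson random measure on `ℂ₀` with intensity `μ`, with values in `M_p(ℂ₀)`. -/
structure IsPoissonRandomMeasure {Ω : Type*} [MeasurableSpace Ω] (Pr : Measure Ω)
    (Φ : Ω → PointMeasure T) (μ : Measure (C0 T)) : Prop where
  measurable : Measurable Φ
  map_eq : ∀ A : Set (C0 T), MeasurableSet A → μ A ≠ ∞ →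
    Pr.map (fun ω => (Φ ω).1 A) =
      (poissonMeasure (μ A).toNNReal).map (fun n : ℕ => (n : ℝ≥0∞))
  ae_eq_top : ∀ A : Set (C0 T), MeasurableSet A → μ A = ∞ → ∀ᵐ ω ∂Pr, (Φ ω).1 A = ∞
  indep : ∀ (n : ℕ) (A : Fin n → Set (C0 T)), (∀ i, MeasurableSet (A i)) →
    Pairwise (fun i j => Disjoint (A i) (A j)) → iIndepFun (fun i ω => (Φ ω).1 (A i)) Pr

/-- The tail function `μ̄_t(x) = μ_t([x, ∞)) = μ {f ; f(t) ≥ x}`, used for `x > 0`. -/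
def tailAt (μ : Measure (C0 T)) (t : T) (x : ℝ) : ℝ≥0∞ := μ {f | x ≤ f t}

/-- Assumption (A) on the finite set `K`: for all `t ∈ K`, `μ̄_t` is continuous on `(0, ∞)` and
`μ̄_t(0+) = ∞`. -/
def AssumptionA (μ : Measure (C0 T)) (K : Finset T) : Prop :=
  ∀ t ∈ K, ContinuousOn (tailAt μ t) (Ioi 0) ∧ Tendsto (tailAt μ t) (𝓝[>] 0) (𝓝 ∞)

/-- `f(s) = (f(s_i))_i`. -/
def evalAt {ι : Type} (s : ι → T) (f : C0 T) : ι → ℝ := fun i => f (s i)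

/-- The exponent measure `μ_s` of `η(s)`, the image of `μ` under `f ↦ f(s)` on `[0,∞)^ι \ {0}`
(seen as a measure on `ℝ^ι`). -/
def marginal {ι : Type} (μ : Measure (C0 T)) (s : ι → T) : Measure (ι → ℝ) :=
  (μ.map (evalAt s)).restrict {0}ᶜ

/-- The tail function `μ̄_s(x) = μ {f ; f(s) ≮ x}`, where `<` means `<` in every coordinate. -/
def tail {ι : Type} (μ : Measure (C0 T)) (s : ι → T) (x : ι → ℝ) : ℝ≥0∞ :=
  μ {f | ¬ ∀ i, f (s i) < x i}

/-- `P` is a regular version of the conditional measure `μ(df)` given `f(s) = x`,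
`x ∈ [0,∞)^ι \ {0}`. The values of `P` at other points `x` are irrelevant. -/
structure IsRegularVersion {ι : Type} (μ : Measure (C0 T)) (s : ι → T)
    (P : Kernel (ι → ℝ) (C0 T)) : Prop where
  isProbabilityMeasure : ∀ x : ι → ℝ, (∀ i, 0 ≤ x i) → x ≠ 0 → IsProbabilityMeasure (P x)
  lintegral_eq : ∀ F : (ι → ℝ) × C0 T → ℝ≥0∞, Measurable F → (∀ f, F (0, f) = 0) →
    ∫⁻ f, F (evalAt s f, f) ∂μ = ∫⁻ x, ∫⁻ f, F (x, f) ∂(P x) ∂(marginal μ s)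

/-- The index set `L̃ = {i ; t_i ∈ L}` of a subset `L` of `{t_1, …, t_k}`. -/
abbrev Idx {k : ℕ} (t : Fin k → T) (L : Finset T) : Type := {i : Fin k // t i ∈ L}

/-- `t_L = (t_i)_{i ∈ L̃}`. -/
def subPoints {k : ℕ} (t : Fin k → T) (L : Finset T) : Idx t L → T := fun i => t i

/-- `y_L = (y_i)_{i ∈ L̃}`. -/
def subVec {k : ℕ} (t : Fin k → T) (L : Finset T) (y : Fin k → ℝ) : Idx t L → ℝ := fun i => y i

variable [DecidableEq T]

/-- The finite set `K = {t_1, …, t_k}`. -/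
abbrev pts {k : ℕ} (t : Fin k → T) : Finset T := Finset.univ.image t

/-- The vector `y ∈ ℝ^k` with given blocks `(y_L)_{L ∈ τ}`. -/
def glue {k : ℕ} (t : Fin k → T) (τ : Finpartition (pts t))
    (z : ∀ L : τ.parts, Idx t L.1 → ℝ) : Fin k → ℝ := fun i =>
  have hi : t i ∈ pts t := Finset.mem_image_of_mem t (Finset.mem_univ i)
  z ⟨τ.part (t i), τ.part_mem.2 hi⟩ ⟨i, τ.mem_part hi⟩

/-- The product measure `⨂_j μ_{t_{τ_j}}(dy_{τ_j})`, as a measure in `y = (y_1, …, y_k)`. -/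
def blockProduct {k : ℕ} (μ : Measure (C0 T)) (t : Fin k → T) (τ : Finpartition (pts t)) :
    Measure (Fin k → ℝ) :=
  (Measure.pi fun L : τ.parts => marginal μ (subPoints t L.1)).map (glue t τ)

/-- The measure
`exp[-μ̄_t(y)] ⨂_j {P_{t_{τ_j}}(y_{τ_j}, {f(t_{τ_j^c}) < y_{τ_j^c}}) μ_{t_{τ_j}}(dy_{τ_j})}`,
with the convention `exp(-∞) = 0`. -/
def explicitLaw {k : ℕ} (μ : Measure (C0 T)) (t : Fin k → T) (τ : Finpartition (pts t))
    (P : ∀ L : Finset T, Kernel (Idx t L → ℝ) (C0 T)) : Measure (Fin k → ℝ) :=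
  (blockProduct μ t τ).withDensity fun y =>
    EReal.exp (-(tail μ t y : EReal)) *
      ∏ L ∈ τ.parts, P L (subVec t L y) {f | ∀ i, t i ∉ L → f (t i) < y i}

/-- The measure `ν_t^τ(C) = Pr(η(t) ∈ C, Θ = τ)`, where `Θ` is the hitting scenario of `Φ`. -/
def scenarioLaw {Ω : Type*} [MeasurableSpace Ω] (Pr : Measure Ω) (Φ : Ω → PointMeasure T)
    (η : Ω → T → ℝ) {k : ℕ} (t : Fin k → T) (τ : Finpartition (pts t)) : Measure (Fin k → ℝ) :=
  (Pr.restrict {ω | hittingScenario (pts t) (Φ ω).1 = τ}).map (fun ω i => η ω (t i))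

end MaxID

end

/-! On `{Θ = τ}` the extremal functions select one atom `x_L` of `Φ` for each block `L`; put `y_i =
x_L(t_i)` for `t_i ∈ L`. Conversely, a tuple of atoms arises in this way exactly when each `x_L` is
strictly below `y` off its block and each set `{f : f(t_i) ≥ y_i}` has `Φ`-mass one. Such a tuple is
unique, so almost surely the indicator of `{η(t) ∈ C, Θ = τ}` is the integral of the indicator of
`scenarioSet` against a product of copies of `Φ` (`lintegral_scenarioSet`).

Admissible tuples have distinct entries, so the multivariate Mecke formula (`lintegral_mecke_pi`)
applies without diagonal terms. The expectation becomes an integral over a product of copies of `μ`,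
with `Φ` replaced by `Φ + ∑ δ_{x_L}`. The added masses already account for the required mass one of
each set, so what remains is that `Φ` itself has no atom in `{f(t) ≮ y}`, an event of probability
`exp(-μ̄_t(y))` (`scenarioLaw_apply`).

The explicit measure unfolds to the same integral (`explicitLaw_apply`). Each factor `μ` is
disintegrated along `f ↦ f(t_L)`; once `y` is fixed, the inequalities attached to different blocks
constrain different functions, and the integral over the kernels factorises. The disintegration
misses the functions vanishing on `t_L`, but these give `y_i = 0`, where (A) forces `μ̄_t(y) = ∞`
and the weight is zero.

(A) also makes the scenario well defined: infinite mass near zero gives `η(t) > 0`, so the maximum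
is attained, and continuity excludes ties, again by the Mecke formula. -/

noncomputable section

set_option linter.unusedSectionVars false

namespace MaxID

universe u

variable {T : Type u} [MetricSpace T] [CompactSpace T]

/-! ### The function space `ℂ₀` -/

namespace C0

lemma nonneg (f : C0 T) (t : T) : 0 ≤ f t := f.2.1 t

lemma norm_pos (f : C0 T) : 0 < ‖f.1‖ := norm_pos_iff.2 f.2.2

lemma apply_le_norm (f : C0 T) (t : T) : f t ≤ ‖f.1‖ :=
  (le_abs_self _).trans (f.1.norm_coe_le_norm t)

lemma measurable_eval (t : T) : Measurable fun f : C0 T => f t := by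
  have : Continuous fun f : C0 T => f.1 t :=
    (continuous_eval_const t).comp continuous_subtype_val
  exact this.measurable

lemma measurable_norm : Measurable fun f : C0 T => ‖f.1‖ :=
  have : Continuous fun f : C0 T => ‖f.1‖ := continuous_norm.comp continuous_subtype_val
  this.measurable

/-- `ℂ₀` is open in the closed cone of non-negative functions of the Polish space `C(T, ℝ)`.
Polishness is what later makes conditional kernels on `ℂ₀` available. -/
instance : PolishSpace (C0 T) := by
  have h1 : IsClosed {f : C(T, ℝ) | ∀ t, 0 ≤ f t} := by
    simp only [ofPred_forall]
    exact isClosed_iInter fun t => isClosed_le continuous_const (continuous_eval_const t)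
  have h2 : IsOpen {f : C(T, ℝ) | f ≠ 0} := isOpen_ne
  have : MeasurableSpace C(T, ℝ) := borel _
  have : PolishSpace {f : C(T, ℝ) | ∀ t, 0 ≤ f t} := h1.polishSpace
  let g : C0 T → {f : C(T, ℝ) | ∀ t, 0 ≤ f t} := fun f => ⟨f.1, f.2.1⟩
  have hg : IsOpenEmbedding g := by
    refine ⟨⟨⟨?_⟩, ?_⟩, ?_⟩
    · change instTopologicalSpaceSubtype = _
      rw [instTopologicalSpaceSubtype, instTopologicalSpaceSubtype, induced_compose]
      rfl
    · intro f f' h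
      exact Subtype.ext (congrArg (fun z => z.1) h)
    · have : range g = Subtype.val ⁻¹' {f : C(T, ℝ) | f ≠ 0} := by
        ext f
        constructor
        · rintro ⟨f', rfl⟩; exact f'.2.2
        · intro hf; exact ⟨⟨f.1, f.2, hf⟩, rfl⟩
      rw [this]
      exact h2.preimage continuous_subtype_val
  have h3 : PolishSpace (range g) := hg.isOpen_range.polishSpace
  exact hg.toIsEmbedding.toHomeomorph.isClosedEmbedding.polishSpace

end C0

/-! ### Finiteness away from the null function -/

lemma measurable_evalAt {ι : Type} (s : ι → T) : Measurable (evalAt (T := T) s) :=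
  measurable_pi_lambda _ fun i => C0.measurable_eval (s i)

/-- The level sets `{f | ⌊1 / ‖f‖⌋ = n}`, which form a partition of `ℂ₀`. -/
def normLevel (n : ℕ) : Set (C0 T) := {f | ⌊1 / ‖f.1‖⌋₊ = n}

lemma measurableSet_normLevel (n : ℕ) : MeasurableSet (normLevel (T := T) n) := by
  have : Measurable fun f : C0 T => ⌊1 / ‖f.1‖⌋₊ :=
    Nat.measurable_floor.comp (C0.measurable_norm.const_div 1)
  exact this (measurableSet_singleton n)

/-- Each level stays away from the null function, so measures finite away from it are finite on
every level. The constant `n + 2` has slack; `n + 1` would do. -/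
lemma normLevel_subset (n : ℕ) :
    normLevel (T := T) n ⊆ {f | 1 / ((n : ℝ) + 2) < ‖f.1‖} := by
  intro f hf
  have h1 : 1 / ‖f.1‖ < (n : ℝ) + 1 := by
    have := Nat.lt_floor_add_one (1 / ‖f.1‖)
    rwa [show ⌊1 / ‖f.1‖⌋₊ = n from hf] at this
  have h0 := f.norm_pos
  rw [div_lt_iff₀ h0] at h1
  simp only [mem_ofPred_eq]
  rw [div_lt_iff₀ (by positivity)]
  nlinarith

lemma iUnion_normLevel : ⋃ n, normLevel (T := T) n = univ :=
  eq_univ_of_forall fun _ => mem_iUnion.2 ⟨_, rfl⟩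

lemma pairwise_disjoint_normLevel :
    Pairwise (Function.onFun Disjoint (normLevel (T := T))) := by
  intro m n hmn
  refine disjoint_left.2 fun f hm hn => hmn ?_
  exact (show ⌊1 / ‖f.1‖⌋₊ = m from hm).symm.trans hn

/-- A measure which is finite away from the null function. -/
def FiniteAway (M : Measure (C0 T)) : Prop := ∀ ε : ℝ, 0 < ε → M {f | ε < ‖f.1‖} < ∞

namespace FiniteAway

variable {M : Measure (C0 T)}

lemma normLevel_lt_top (h : FiniteAway M) (n : ℕ) : M (normLevel n) < ∞ :=
  (measure_mono (normLevel_subset n)).trans_lt (h _ (by positivity))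

lemma le_eval_lt_top (h : FiniteAway M) (t : T) {x : ℝ} (hx : 0 < x) : M {f | x ≤ f t} < ∞ := by
  -- Halving turns the weak inequality `x ≤ f t` into a strict one for the norm.
  refine (measure_mono fun f hf => ?_).trans_lt (h (x / 2) (by positivity))
  have := f.apply_le_norm t
  have h2 : x ≤ f t := hf
  simp only [mem_ofPred_eq]
  linarith

lemma sigmaFinite (h : FiniteAway M) : SigmaFinite M :=
  ⟨⟨⟨normLevel, fun _ => trivial, h.normLevel_lt_top, iUnion_normLevel⟩⟩⟩

lemma sigmaFinite_marginal (h : FiniteAway M) {ι : Type} [Fintype ι] (s : ι → T) :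
    SigmaFinite (marginal M s) := by
  -- The origin is added so that the sets cover the whole space; it costs nothing because the
  -- marginal is restricted to `{0}ᶜ`.
  refine ⟨⟨⟨fun n => {x | x = 0 ∨ ∃ i, 1 / ((n : ℝ) + 1) < |x i|}, fun _ => trivial, fun n => ?_,
    ?_⟩⟩⟩
  · have hm : MeasurableSet {x : ι → ℝ | x = 0 ∨ ∃ i, 1 / ((n : ℝ) + 1) < |x i|} := by
      have h1 : MeasurableSet {x : ι → ℝ | ∃ i, 1 / ((n : ℝ) + 1) < |x i|} := by
        rw [ofPred_exists]
        exact MeasurableSet.iUnion fun i => measurableSet_lt measurable_const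
          (measurable_pi_apply i).abs
      exact (measurableSet_singleton (0 : ι → ℝ)).union h1
    rw [marginal, Measure.restrict_apply hm, Measure.map_apply (measurable_evalAt s)
      (hm.inter (measurableSet_singleton _).compl)]
    refine (measure_mono ?_).trans_lt (h (1 / ((n : ℝ) + 1)) (by positivity))
    rintro f ⟨h1 | ⟨i, hi⟩, h2⟩
    · exact absurd h1 h2
    · exact hi.trans_le (f.1.norm_coe_le_norm (s i))
  · refine eq_univ_of_forall fun x => ?_
    by_cases hx : x = 0
    · exact mem_iUnion.2 ⟨0, Or.inl hx⟩
    · obtain ⟨i, hi⟩ := Function.ne_iff.1 hx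
      obtain ⟨n, hn⟩ := exists_nat_one_div_lt (abs_pos.2 hi)
      exact mem_iUnion.2 ⟨n, Or.inr ⟨i, hn⟩⟩

end FiniteAway

/-! ### Atoms and maxima of a point measure -/

namespace IsPointMeasure

variable {M : Measure (C0 T)}

lemma finiteAway (h : IsPointMeasure M) : FiniteAway M := by
  obtain ⟨ι, hι, f, rfl, hf⟩ := h
  intro ε hε
  have hm : MeasurableSet {g : C0 T | ε < ‖g.1‖} :=
    measurableSet_lt measurable_const C0.measurable_norm
  rw [Measure.sum_apply _ hm, tsum_eq_sum (s := (hf ε hε).toFinset)]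
  · refine ENNReal.sum_lt_top.2 fun i _ => ?_
    exact (measure_lt_top _ _)
  · intro i hi
    rw [Measure.dirac_apply' _ hm]
    refine indicator_of_notMem (fun h => hi ?_) _
    simpa using h

/-- A non-zero countable sum has a non-zero term. This translates between masses, which are
measurable in `M`, and atoms. -/
lemma measure_ne_zero_iff (h : IsPointMeasure M) {S : Set (C0 T)} (hS : MeasurableSet S) :
    M S ≠ 0 ↔ ∃ f ∈ atoms M, f ∈ S := by
  refine ⟨fun h0 => ?_, fun ⟨f, hf, hfS⟩ h0 => hf (measure_mono_null (singleton_subset_iff.2 hfS) h0)⟩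
  obtain ⟨ι, hι, f, rfl, hf⟩ := h
  rw [Measure.sum_apply _ hS, Ne, ENNReal.tsum_eq_zero, not_forall] at h0
  obtain ⟨i, hi⟩ := h0
  rw [Measure.dirac_apply' _ hS] at hi
  refine ⟨f i, ?_, by_contra fun hn => hi (indicator_of_notMem hn _)⟩
  simp only [atoms, mem_ofPred_eq]
  rw [Measure.sum_apply _ (measurableSet_singleton _), Ne, ENNReal.tsum_eq_zero, not_forall]
  exact ⟨i, by simp⟩

lemma one_le_of_mem_atoms (h : IsPointMeasure M) {f : C0 T} (hf : f ∈ atoms M) : 1 ≤ M {f} := by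
  obtain ⟨ι, hι, g, rfl, hg⟩ := h
  simp only [atoms, mem_ofPred_eq] at hf
  rw [Measure.sum_apply _ (measurableSet_singleton _)] at hf ⊢
  rw [Ne, ENNReal.tsum_eq_zero, not_forall] at hf
  obtain ⟨i, hi⟩ := hf
  refine le_trans ?_ (ENNReal.le_tsum i)
  rw [Measure.dirac_apply' _ (measurableSet_singleton _)] at hi ⊢
  have hmem : g i ∈ ({f} : Set (C0 T)) := by_contra fun hn => hi (indicator_of_notMem hn _)
  rw [indicator_of_mem hmem]
  rfl

lemma countable_atoms (h : IsPointMeasure M) : (atoms M).Countable := by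
  obtain ⟨ι, hι, g, rfl, hg⟩ := h
  refine (countable_range g).mono fun f hf => ?_
  by_contra hn
  refine hf ?_
  rw [Measure.sum_apply _ (measurableSet_singleton _), ENNReal.tsum_eq_zero]
  intro i
  rw [Measure.dirac_apply' _ (measurableSet_singleton _)]
  exact indicator_of_notMem (fun h : g i ∈ ({f} : Set (C0 T)) => hn ⟨i, h⟩) _

lemma ae_mem_atoms (h : IsPointMeasure M) : ∀ᵐ f ∂M, f ∈ atoms M := by
  have hm : MeasurableSet (atoms M) := h.countable_atoms.measurableSet
  rw [ae_iff]
  by_contra h0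
  obtain ⟨f, hf, hf'⟩ := (h.measure_ne_zero_iff hm.compl).1 h0
  exact hf' hf

/-- If `M` gives mass `1` to `S`, and `f ∈ S` is an atom, then `M` coincides with `δ_f` on `S`. -/
lemma restrict_eq_dirac (h : IsPointMeasure M) {S : Set (C0 T)} (h1 : M S = 1) {f : C0 T} (hf : f ∈ atoms M) (hfS : f ∈ S) :
    M.restrict S = Measure.dirac f := by
  have h2 := h.one_le_of_mem_atoms hf
  -- An atom weighs at least one, so `f` uses up the whole mass of `S`.
  have h3 : M (S ∩ {f}) = 1 := by
    refine le_antisymm ((measure_mono inter_subset_left).trans h1.le) ?_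
    rwa [inter_eq_self_of_subset_right (singleton_subset_iff.2 hfS)]
  have h4 : M (S \ {f}) = 0 := by
    have := measure_inter_add_sdiff (μ := M) S (measurableSet_singleton f)
    rw [h1, h3] at this
    have h5 : (1 : ℝ≥0∞) + M (S \ {f}) = 1 + 0 := by simpa using this
    exact (ENNReal.add_right_inj ENNReal.one_ne_top).1 h5
  ext A hA
  rw [Measure.restrict_apply hA, Measure.dirac_apply' _ hA]
  by_cases hfA : f ∈ A
  · rw [indicator_of_mem hfA, Pi.one_apply]
    refine le_antisymm ((measure_mono inter_subset_right).trans h1.le) ?_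
    exact h2.trans (measure_mono (singleton_subset_iff.2 ⟨hfA, hfS⟩))
  · rw [indicator_of_notMem hfA]
    refine measure_mono_null (t := S \ {f}) (fun g hg => ⟨hg.2, fun hgf => hfA ?_⟩) h4
    rw [← show g = f from hgf]
    exact hg.1

lemma exists_restrict_eq_dirac_iff (h : IsPointMeasure M) {S : Set (C0 T)} (hS : MeasurableSet S) :
    (∃ f, M.restrict S = Measure.dirac f) ↔ M S = 1 := by
  constructor
  · rintro ⟨f, hf⟩
    rw [← Measure.restrict_apply_univ, hf, measure_univ]
  · intro h1
    obtain ⟨f, hf, hfS⟩ := (h.measure_ne_zero_iff hS).1 (by rw [h1]; exact one_ne_zero)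
    exact ⟨f, h.restrict_eq_dirac h1 hf hfS⟩

/-- Infinitely many atoms of mass at least one would give `{ε < ‖f‖}` infinite mass. -/
lemma finite_atoms (h : IsPointMeasure M) {ε : ℝ} (hε : 0 < ε) :
    {f | f ∈ atoms M ∧ ε < ‖f.1‖}.Finite := by
  by_contra hinf
  have h1 : M {f | f ∈ atoms M ∧ ε < ‖f.1‖} = ∞ :=
    Set.Infinite.meas_eq_top hinf ⟨1, one_ne_zero, fun f hf => h.one_le_of_mem_atoms hf.1⟩
  have h2 : M {f | f ∈ atoms M ∧ ε < ‖f.1‖} ≤ M {f | ε < ‖f.1‖} := measure_mono fun f hf => hf.2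
  exact (h2.trans_lt (h.finiteAway ε hε)).ne h1

lemma bddAbove_eval_atoms (h : IsPointMeasure M) (t : T) :
    BddAbove {x | ∃ f ∈ atoms M, x = f t} := by
  have hfin := (h.finite_atoms one_pos).image fun f => f t
  obtain ⟨b, hb⟩ := hfin.bddAbove
  refine ⟨max b 1, ?_⟩
  rintro x ⟨f, hf, rfl⟩
  by_cases hn : 1 < ‖f.1‖
  · exact le_max_of_le_left (hb ⟨f, ⟨hf, hn⟩, rfl⟩)
  · exact le_max_of_le_right ((f.apply_le_norm t).trans (not_lt.1 hn))

lemma le_maxFun (h : IsPointMeasure M) {f : C0 T} (hf : f ∈ atoms M) (t : T) :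
    f t ≤ maxFun M t :=
  le_csSup (h.bddAbove_eval_atoms t) ⟨f, hf, rfl⟩

lemma maxFun_nonneg (M : Measure (C0 T)) (t : T) : 0 ≤ maxFun M t := by
  refine Real.sSup_nonneg ?_
  rintro x ⟨f, -, rfl⟩
  exact f.nonneg t

/-- A positive maximum is attained. -/
lemma exists_atom_eq_maxFun (h : IsPointMeasure M) {t : T} (h0 : 0 < maxFun M t) :
    ∃ f ∈ atoms M, f t = maxFun M t := by
  have hne : {x | ∃ f ∈ atoms M, x = f t}.Nonempty := by
    by_contra hn
    rw [not_nonempty_iff_eq_empty] at hn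
    rw [maxFun, hn, Real.sSup_empty] at h0
    exact h0.false
  -- Only finitely many atoms exceed half of the positive supremum, and the largest of their values
  -- is the supremum.
  have hfin : {x | ∃ f ∈ atoms M, x = f t ∧ maxFun M t / 2 < x}.Finite := by
    refine ((h.finite_atoms (half_pos h0)).image fun f => f t).subset ?_
    rintro x ⟨f, hf, rfl, hx⟩
    exact ⟨f, ⟨hf, hx.trans_le (f.apply_le_norm t)⟩, rfl⟩
  obtain ⟨x, ⟨f, hf, rfl⟩, hx⟩ := exists_lt_of_lt_csSup hne (half_lt_self h0)
  obtain ⟨y, ⟨g, hg, rfl, hy⟩, hmax⟩ := hfin.exists_maximal ⟨f t, f, hf, rfl, hx⟩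
  refine ⟨g, hg, le_antisymm (h.le_maxFun hg t) (csSup_le hne ?_)⟩
  rintro z ⟨g', hg', rfl⟩
  by_cases hz : maxFun M t / 2 < g' t
  · by_contra hlt
    exact hlt (hmax ⟨g', hg', rfl, hz⟩ (not_le.1 hlt).le)
  · exact (not_lt.1 hz).trans hy.le

/-- Attainment makes the equivalence exact with weak inequalities. It expresses the level sets of
the maximum through masses, hence the measurability of `η(t)`. -/
lemma le_maxFun_iff (h : IsPointMeasure M) {t : T} {x : ℝ} (hx : 0 < x) :
    x ≤ maxFun M t ↔ M {f | x ≤ f t} ≠ 0 := by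
  rw [h.measure_ne_zero_iff (measurableSet_le measurable_const (C0.measurable_eval t))]
  constructor
  · intro hle
    obtain ⟨f, hf, hft⟩ := h.exists_atom_eq_maxFun (hx.trans_le hle)
    exact ⟨f, hf, hle.trans hft.ge⟩
  · rintro ⟨f, hf, hfx⟩
    exact le_trans hfx (h.le_maxFun hf t)

lemma add_dirac (h : IsPointMeasure M) (f : C0 T) : IsPointMeasure (M + Measure.dirac f) := by
  obtain ⟨ι, hι, g, rfl, hg⟩ := h
  refine ⟨ι ⊕ Unit, inferInstance, Sum.elim g fun _ => f, ?_, fun ε hε => ?_⟩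
  · ext A hA
    rw [Measure.add_apply, Measure.sum_apply _ hA, Measure.sum_apply _ hA,
      Summable.tsum_sum ENNReal.summable ENNReal.summable]
    simp
  · refine (((hg ε hε).image Sum.inl).insert (Sum.inr ())).subset ?_
    rintro (i | _) hi
    · exact mem_insert_of_mem _ ⟨i, hi, rfl⟩
    · exact mem_insert _ _

lemma add_sum_dirac (h : IsPointMeasure M) {ι : Type*} (s : Finset ι) (x : ι → C0 T) :
    IsPointMeasure (M + ∑ i ∈ s, Measure.dirac (x i)) := by
  classical
  induction s using Finset.induction_on with
  | empty => simpa using h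
  | insert a s ha ih =>
    rw [Finset.sum_insert ha, add_comm (Measure.dirac _), ← add_assoc]
    exact ih.add_dirac _

end IsPointMeasure

/-! ### Measurability on the space of point measures -/

namespace PointMeasure

/-- The underlying measure of a point measure. -/
def toMeasure (M : PointMeasure T) : Measure (C0 T) := M.1

lemma isPointMeasure (M : PointMeasure T) : IsPointMeasure M.toMeasure := M.2

instance (M : PointMeasure T) : SigmaFinite M.toMeasure := M.isPointMeasure.finiteAway.sigmaFinite

/-- Adding finitely many Dirac masses to a point measure. -/
def addDiracs {ι : Type*} [Fintype ι] (M : PointMeasure T) (x : ι → C0 T) : PointMeasure T :=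
  ⟨M.1 + ∑ i, Measure.dirac (x i), M.2.add_sum_dirac _ x⟩

lemma toMeasure_addDiracs {ι : Type*} [Fintype ι] (M : PointMeasure T) (x : ι → C0 T) :
    (M.addDiracs x).toMeasure = M.toMeasure + ∑ i, Measure.dirac (x i) := rfl

/-- Adding a Dirac mass to a point measure. -/
def addDirac (M : PointMeasure T) (f : C0 T) : PointMeasure T :=
  ⟨M.1 + Measure.dirac f, M.2.add_dirac f⟩

lemma toMeasure_addDirac (M : PointMeasure T) (f : C0 T) :
    (M.addDirac f).toMeasure = M.toMeasure + Measure.dirac f := rfl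

lemma measurable_of_measurable_coe {α : Type*} [MeasurableSpace α] {g : α → PointMeasure T}
    (h : ∀ A : Set (C0 T), MeasurableSet A → Measurable fun a => (g a).toMeasure A) : Measurable g :=
  Measurable.subtype_mk (f := fun a => (g a).1) (Measure.measurable_of_measurable_coe _ h)

lemma measurable_toMeasure : Measurable (toMeasure (T := T)) := measurable_subtype_coe

lemma measurable_coe {A : Set (C0 T)} (hA : MeasurableSet A) :
    Measurable fun M : PointMeasure T => M.toMeasure A :=
  (Measure.measurable_coe hA).comp measurable_toMeasure

lemma measurable_addDirac :
    Measurable fun p : PointMeasure T × C0 T => p.1.addDirac p.2 := by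
  refine measurable_of_measurable_coe fun A hA => ?_
  simp only [toMeasure_addDirac, Measure.add_apply]
  refine ((measurable_coe hA).comp measurable_fst).add ?_
  exact (Measure.measurable_coe hA).comp (Measure.measurable_dirac.comp measurable_snd)

lemma measurable_addDiracs {ι : Type*} [Fintype ι] :
    Measurable fun p : PointMeasure T × (ι → C0 T) => p.1.addDiracs p.2 := by
  refine measurable_of_measurable_coe fun A hA => ?_
  simp only [toMeasure_addDiracs, Measure.add_apply, Measure.coe_finsetSum, Finset.sum_apply]
  refine ((measurable_coe hA).comp measurable_fst).add (Finset.measurable_fun_sum _ fun i _ => ?_)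
  exact (Measure.measurable_coe hA).comp
    (Measure.measurable_dirac.comp ((measurable_pi_apply i).comp measurable_snd))

variable (T) in
/-- The identity of `M_p(ℂ₀)`, as a kernel. -/
def kernel : Kernel (PointMeasure T) (C0 T) := ⟨toMeasure, measurable_toMeasure⟩

lemma kernel_apply (M : PointMeasure T) : kernel T M = M.toMeasure := rfl

/-- The event that `M(normLevel n)` is about `m`. -/
def massLevel (n m : ℕ) : Set (PointMeasure T) := {M | ⌊(M.toMeasure (normLevel n)).toReal⌋₊ = m}

lemma measurableSet_massLevel (n m : ℕ) : MeasurableSet (massLevel (T := T) n m) :=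
  (Nat.measurable_floor.comp (measurable_coe (measurableSet_normLevel n)).ennreal_toReal)
    (measurableSet_singleton m)

-- Point measures have infinite mass in general and no uniform bound on norm levels, so the identity
-- kernel is cut both by the level `n` and by the integer part `m` of the mass of that level. The
-- piece `(n, m)` is bounded by `m + 1`.
open Classical in
instance : IsSFiniteKernel (kernel T) := by
  let κ : ℕ × ℕ → Kernel (PointMeasure T) (C0 T) := fun p =>
    Kernel.piecewise (measurableSet_massLevel p.1 p.2)
      ((kernel T).restrict (measurableSet_normLevel p.1)) 0
  have h1 : ∀ p, IsFiniteKernel (κ p) := by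
    intro p
    refine ⟨⟨(p.2 : ℝ≥0∞) + 1, by finiteness, fun M => ?_⟩⟩
    simp only [κ, Kernel.piecewise_apply]
    split_ifs with hM
    · rw [Kernel.restrict_apply, Measure.restrict_apply_univ, kernel_apply]
      have h2 := M.isPointMeasure.finiteAway.normLevel_lt_top p.1
      have h3 : (M.toMeasure (normLevel p.1)).toReal < p.2 + 1 := by
        have := Nat.lt_floor_add_one (M.toMeasure (normLevel p.1)).toReal
        rwa [show ⌊(M.toMeasure (normLevel p.1)).toReal⌋₊ = p.2 from hM] at this
      rw [← ENNReal.ofReal_toReal h2.ne]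
      refine (ENNReal.ofReal_le_ofReal h3.le).trans ?_
      rw [ENNReal.ofReal_add (by positivity) zero_le_one]
      simp
    · simp
  have h2 : kernel T = Kernel.sum κ := by
    ext M A hA
    rw [Kernel.sum_apply' _ _ hA, ENNReal.tsum_prod']
    have h3 : ∀ n, ∑' m, κ (n, m) M A = M.toMeasure (A ∩ normLevel n) := by
      intro n
      rw [tsum_eq_single ⌊(M.toMeasure (normLevel n)).toReal⌋₊]
      · have : M ∈ massLevel n ⌊(M.toMeasure (normLevel n)).toReal⌋₊ := rfl
        simp only [κ, Kernel.piecewise_apply, this, if_true]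
        rw [Kernel.restrict_apply, Measure.restrict_apply hA, kernel_apply]
      · intro m hm
        have : M ∉ massLevel n m := fun h => hm (Eq.symm h)
        simp [κ, Kernel.piecewise_apply, this]
    simp only [h3]
    rw [← measure_iUnion, ← inter_iUnion, iUnion_normLevel, inter_univ, kernel_apply]
    · exact fun i j hij => (pairwise_disjoint_normLevel hij).mono inter_subset_right
        inter_subset_right
    · exact fun n => hA.inter (measurableSet_normLevel n)
  rw [h2]
  exact Kernel.isSFiniteKernel_sum

lemma measurable_maxFun (t : T) : Measurable fun M : PointMeasure T => maxFun M.toMeasure t := by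
  refine measurable_of_Ici fun x => ?_
  by_cases hx : 0 < x
  · have : (fun M : PointMeasure T => maxFun M.toMeasure t) ⁻¹' Ici x
        = (fun M : PointMeasure T => M.toMeasure {f | x ≤ f t}) ⁻¹' {0}ᶜ := by
      ext M
      exact M.isPointMeasure.le_maxFun_iff hx
    rw [this]
    exact measurable_coe (measurableSet_le measurable_const (C0.measurable_eval t))
      (measurableSet_singleton _).compl
  · have : (fun M : PointMeasure T => maxFun M.toMeasure t) ⁻¹' Ici x = univ :=
      eq_univ_of_forall fun M => (not_lt.1 hx).trans (IsPointMeasure.maxFun_nonneg _ t)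
    rw [this]
    exact MeasurableSet.univ

/-- The set whose mass is taken may depend on the point measure itself, as extremal sets do, and on
an additional parameter. -/
lemma measurable_measure_prodMk {α : Type*} [MeasurableSpace α] {S : Set ((α × PointMeasure T) × C0 T)}
    (hS : MeasurableSet S) : Measurable fun p : α × PointMeasure T => p.2.toMeasure {f | (p, f) ∈ S} :=
  Kernel.measurable_kernel_prodMk_left (κ := (kernel T).comap Prod.snd measurable_snd) hS

end PointMeasure

end MaxID

end

/-! ### Void probabilities and the Mecke identity for cylinder functions -/

noncomputable section

set_option linter.unusedSectionVars false

/-- The Mecke identity for a Poisson random variable. -/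
lemma lintegral_mul_poissonMeasure (r : ℝ≥0) (g : ℝ≥0∞ → ℝ≥0∞) (hg : Measurable g) :
    ∫⁻ x, x * g x ∂(poissonMeasure r).map (fun n : ℕ => (n : ℝ≥0∞)) =
      r * ∫⁻ x, g (x + 1) ∂(poissonMeasure r).map (fun n : ℕ => (n : ℝ≥0∞)) := by
  rw [lintegral_map (by fun_prop) .of_discrete, lintegral_map (by fun_prop) .of_discrete,
    poissonMeasure, lintegral_sum_measure, lintegral_sum_measure]
  simp only [lintegral_smul_measure, lintegral_dirac, smul_eq_mul]
  -- The factor `x` kills the term at zero; after the shift, the Poisson weights satisfy `(n + 1)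
  -- p(n + 1) = r p(n)`.
  rw [tsum_eq_zero_add' ENNReal.summable, ← ENNReal.tsum_mul_left]
  simp only [Nat.cast_zero, zero_mul, mul_zero, zero_add]
  congr 1
  ext n
  have h1 : ENNReal.ofReal (Real.exp (-r) * (r : ℝ) ^ (n + 1) / ((n + 1).factorial : ℝ)) *
      ((n + 1 : ℕ) : ℝ≥0∞) = r * ENNReal.ofReal (Real.exp (-r) * (r : ℝ) ^ n / (n.factorial : ℝ)) := by
    rw [← ENNReal.ofReal_natCast, ← ENNReal.ofReal_coe_nnreal,
      ← ENNReal.ofReal_mul (by positivity), ← ENNReal.ofReal_mul (by positivity)]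
    congr 1
    rw [Nat.factorial_succ]
    push_cast
    field_simp
    ring
  rw [← mul_assoc, h1]
  push_cast
  ring

namespace MaxID

universe u

variable {T : Type u} [MetricSpace T] [CompactSpace T] {Ω : Type*} [MeasurableSpace Ω]
  {Pr : Measure Ω} [IsProbabilityMeasure Pr] {μ : Measure (C0 T)} {Φ : Ω → PointMeasure T}

namespace IsPoissonRandomMeasure

/-- If `μ` were infinite on `{ε < ‖f‖}`, so would be `Φ` almost surely, which its values in
`M_p(ℂ₀)` forbid. -/
lemma finiteAway (hΦ : IsPoissonRandomMeasure Pr Φ μ) : FiniteAway μ := by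
  intro ε hε
  by_contra h
  have h1 := hΦ.ae_eq_top _ (measurableSet_lt measurable_const C0.measurable_norm)
    (not_lt_top_iff.1 h)
  obtain ⟨ω, hω⟩ := h1.exists
  exact ((Φ ω).isPointMeasure.finiteAway ε hε).ne hω

lemma measurable_count (hΦ : IsPoissonRandomMeasure Pr Φ μ) {A : Set (C0 T)}
    (hA : MeasurableSet A) : Measurable fun ω => (Φ ω).toMeasure A :=
  (PointMeasure.measurable_coe hA).comp hΦ.measurable

lemma map_count (hΦ : IsPoissonRandomMeasure Pr Φ μ) {A : Set (C0 T)}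
    (hA : MeasurableSet A) (h : μ A ≠ ∞) : Pr.map (fun ω => (Φ ω).toMeasure A) =
      (poissonMeasure (μ A).toNNReal).map (fun n : ℕ => (n : ℝ≥0∞)) :=
  hΦ.map_eq A hA h

lemma ae_count_eq_top (hΦ : IsPoissonRandomMeasure Pr Φ μ) {A : Set (C0 T)}
    (hA : MeasurableSet A) (h : μ A = ∞) : ∀ᵐ ω ∂Pr, (Φ ω).toMeasure A = ∞ :=
  hΦ.ae_eq_top A hA h

/-- Void probabilities. -/
lemma measure_count_eq_zero (hΦ : IsPoissonRandomMeasure Pr Φ μ) {A : Set (C0 T)}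
    (hA : MeasurableSet A) : Pr {ω | (Φ ω).toMeasure A = 0} = EReal.exp (-(μ A : EReal)) := by
  by_cases h : μ A = ∞
  · have h1 : Pr {ω | (Φ ω).toMeasure A = 0} = 0 := by
      refine measure_mono_null ?_ (ae_iff.1 (hΦ.ae_count_eq_top hA h))
      intro ω hω h2
      rw [show (Φ ω).toMeasure A = 0 from hω] at h2
      exact ENNReal.zero_ne_top h2
    rw [h1, h]
    simp
  · have h1 : Pr {ω | (Φ ω).toMeasure A = 0} = Pr.map (fun ω => (Φ ω).toMeasure A) {0} := by
      rw [Measure.map_apply (hΦ.measurable_count hA) (measurableSet_singleton _)]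
      rfl
    rw [h1, hΦ.map_count hA h, Measure.map_apply .of_discrete (measurableSet_singleton _)]
    have h2 : (fun n : ℕ => (n : ℝ≥0∞)) ⁻¹' {0} = {0} := by ext n; simp
    rw [h2, poissonMeasure_singleton]
    lift μ A to ℝ≥0 using h with r
    simp only [ENNReal.toNNReal_coe, pow_zero, mul_one, Nat.factorial_zero, Nat.cast_one, div_one]
    rfl

/-- `Φ(C)` is independent of the counts of finitely many sets which are disjoint from `C`. -/
lemma indepFun_count (hΦ : IsPoissonRandomMeasure Pr Φ μ) {ι : Type*} [Fintype ι]
    {C : Set (C0 T)} (hC : MeasurableSet C) {D : ι → Set (C0 T)} (hD : ∀ i, MeasurableSet (D i))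
    (hCD : ∀ i, Disjoint (D i) C) :
    IndepFun (fun ω => (Φ ω).toMeasure C) (fun ω i => (Φ ω).toMeasure (D i)) Pr := by
  classical
  -- Independence is assumed only for disjoint sets, while the `D i` may overlap. The signature
  -- records which `D i` contain `f`; its level sets, minus `C`, are disjoint pieces of which every
  -- `D i` is a union.
  let sig : C0 T → Finset ι := fun f => Finset.univ.filter fun i => f ∈ D i
  have hsig : ∀ J, MeasurableSet (sig ⁻¹' {J}) := by
    intro J
    have : sig ⁻¹' {J} = ⋂ i, {f | f ∈ D i ↔ i ∈ J} := by
      ext f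
      simp [sig, Finset.ext_iff]
    rw [this]
    refine MeasurableSet.iInter fun i => ?_
    by_cases hi : i ∈ J
    · simpa [hi] using hD i
    · simp only [hi, iff_false]
      exact (hD i).compl
  -- The label `none` stands for `C`, the label `some J` for the piece of signature `J`.
  let A : Option (Finset ι) → Set (C0 T) := fun o => o.elim C fun J => sig ⁻¹' {J} \ C
  have hA : ∀ o, MeasurableSet (A o) := by
    rintro (_ | J)
    · exact hC
    · exact (hsig J).diff hC
  have hdisj : Pairwise fun o o' => Disjoint (A o) (A o') := by
    rintro (_ | J) (_ | J') hne
    · exact absurd rfl hne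
    · exact disjoint_sdiff_right
    · exact disjoint_sdiff_left
    · refine disjoint_left.2 fun f hf hf' => hne ?_
      exact congrArg some ((show sig f = J from hf.1).symm.trans hf'.1)
  have hind : iIndepFun (fun o ω => (Φ ω).toMeasure (A o)) Pr := by
    let e := Fintype.equivFin (Option (Finset ι))
    have := (hΦ.indep _ (A ∘ e.symm) (fun i => hA _)
      (fun i j hij => hdisj (e.symm.injective.ne hij))).precomp e.injective
    convert this using 3 with o
    simp only [Function.comp_apply, Equiv.symm_apply_apply]
    rfl
  have hind2 := hind.indepFun_finset {none} (Finset.univ.erase none) (by simp)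
    (fun o => hΦ.measurable_count (hA o))
  have hadd : ∀ i ω, (Φ ω).toMeasure (D i) = ∑ o ∈ (Finset.univ.erase none : Finset (Option (Finset ι))).attach,
      if ∃ J, o.1 = some J ∧ i ∈ J then (Φ ω).toMeasure (A o.1) else 0 := by
    intro i ω
    rw [Finset.sum_attach (Finset.univ.erase none : Finset (Option (Finset ι)))
      (fun o => if ∃ J, o = some J ∧ i ∈ J then (Φ ω).toMeasure (A o) else 0), ← Finset.sum_filter,
      ← measure_biUnion_finset (fun o _ o' _ h => hdisj h) (fun o _ => hA o)]
    congr 1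
    ext f
    simp only [Finset.mem_filter, Finset.mem_erase, Finset.mem_univ, and_true, mem_iUnion,
      exists_prop]
    constructor
    · intro hf
      exact ⟨some (sig f), ⟨by simp, sig f, rfl, by simpa [sig] using hf⟩, rfl,
        disjoint_left.1 (hCD i) hf⟩
    · rintro ⟨o, ⟨-, J, rfl, hJ⟩, hf, -⟩
      have : sig f = J := hf
      rw [← this] at hJ
      simpa [sig] using hJ
  have hφ : Measurable fun v : ↥({none} : Finset (Option (Finset ι))) → ℝ≥0∞ =>
      v ⟨none, Finset.mem_singleton_self none⟩ := measurable_pi_apply _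
  have hψ : Measurable fun v : ↥(Finset.univ.erase none : Finset (Option (Finset ι))) → ℝ≥0∞ =>
      fun i : ι => ∑ o ∈ (Finset.univ.erase none : Finset (Option (Finset ι))).attach,
        if ∃ J, o.1 = some J ∧ i ∈ J then v o else 0 :=
    measurable_pi_lambda _ fun i => Finset.measurable_fun_sum _ fun o _ => by
      split_ifs
      · exact measurable_pi_apply o
      · exact measurable_const
  have := hind2.comp hφ hψ
  convert this using 1
  · rfl
  funext ω i
  exact hadd i ω

/-- The Mecke identity for a set `A` which is not split by the sets `B i`. -/
lemma lintegral_count_mul_of_atom (hΦ : IsPoissonRandomMeasure Pr Φ μ) {ι : Type*} [Fintype ι]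
    {A : Set (C0 T)} (hA : MeasurableSet A) (hμA : μ A ≠ ∞) {B : ι → Set (C0 T)}
    (hB : ∀ i, MeasurableSet (B i)) (J : Set ι) (hJ : ∀ i ∈ J, A ⊆ B i)
    (hJ' : ∀ i ∉ J, Disjoint (B i) A) {g : (ι → ℝ≥0∞) → ℝ≥0∞} (hg : Measurable g) :
    ∫⁻ ω, (Φ ω).toMeasure A * g (fun i => (Φ ω).toMeasure (B i)) ∂Pr =
      μ A * ∫⁻ ω, g (fun i => (Φ ω).toMeasure (B i) + J.indicator 1 i) ∂Pr := by
  have hX := hΦ.measurable_count hA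
  have hY : Measurable fun ω i => (Φ ω).toMeasure (B i \ A) :=
    measurable_pi_lambda _ fun i => hΦ.measurable_count ((hB i).diff hA)
  have hind : IndepFun (fun ω i => (Φ ω).toMeasure (B i \ A)) (fun ω => (Φ ω).toMeasure A) Pr :=
    (hΦ.indepFun_count hA (fun i => (hB i).diff hA) (fun i => disjoint_sdiff_left)).symm
  rw [indepFun_iff_map_prod_eq_prod_map_map hY.aemeasurable hX.aemeasurable] at hind
  -- All counts are functions of `Φ(A)` and of the independent vector of the `Φ(B i \ A)`. With the
  -- latter frozen, only the identity for one Poisson variable is needed.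
  have hBeq : ∀ ω i, (Φ ω).toMeasure (B i) = (Φ ω).toMeasure (B i \ A) + J.indicator 1 i * (Φ ω).toMeasure A := by
    intro ω i
    by_cases hi : i ∈ J
    · rw [indicator_of_mem hi, Pi.one_apply, one_mul, add_comm]
      rw [← measure_inter_add_sdiff (B i) hA, inter_eq_self_of_subset_right (hJ i hi)]
    · rw [indicator_of_notMem hi, zero_mul, add_zero, (hJ' i hi).sdiff_eq_left]
  have hm : Measurable fun p : (ι → ℝ≥0∞) × ℝ≥0∞ => g (fun i => p.1 i + J.indicator 1 i * p.2) :=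
    hg.comp (by fun_prop)
  have hm2 : Measurable fun p : (ι → ℝ≥0∞) × ℝ≥0∞ =>
      g (fun i => p.1 i + J.indicator 1 i * (p.2 + 1)) :=
    hg.comp (by fun_prop)
  have hp1 : ∀ G : (ι → ℝ≥0∞) × ℝ≥0∞ → ℝ≥0∞, Measurable G →
      ∫⁻ ω, G (fun i => (Φ ω).toMeasure (B i \ A), (Φ ω).toMeasure A) ∂Pr =
      ∫⁻ y, ∫⁻ x, G (y, x) ∂((poissonMeasure (μ A).toNNReal).map (fun n : ℕ => (n : ℝ≥0∞)))
        ∂Pr.map fun ω i => (Φ ω).toMeasure (B i \ A) := by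
    intro G hG
    rw [← lintegral_map (f := G) hG (hY.prodMk hX), hind, lintegral_prod _ hG.aemeasurable,
      hΦ.map_count hA hμA]
  simp_rw [hBeq, add_assoc]
  have e1 := hp1 (fun p => p.2 * g (fun i => p.1 i + J.indicator 1 i * p.2))
    (measurable_snd.mul hm)
  have e2 := hp1 (fun p => g (fun i => p.1 i + J.indicator 1 i * (p.2 + 1))) hm2
  simp only at e1 e2
  rw [e1]
  have e3 : ∀ (ω : Ω) i, J.indicator 1 i * (Φ ω).toMeasure A + J.indicator 1 i =
      J.indicator (1 : ι → ℝ≥0∞) i * ((Φ ω).toMeasure A + 1) := fun ω i => by rw [mul_add, mul_one]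
  simp_rw [e3]
  rw [e2, ← lintegral_const_mul']
  · congr 1
    ext y
    rw [lintegral_mul_poissonMeasure _ (fun x => g (fun i => y i + J.indicator 1 i * x))
      (hg.comp (by fun_prop)), ENNReal.coe_toNNReal hμA]
  · exact hμA

/-- The Mecke identity for cylinder functions. -/
lemma lintegral_count_mul (hΦ : IsPoissonRandomMeasure Pr Φ μ) {ι : Type*} [Fintype ι]
    {A : Set (C0 T)} (hA : MeasurableSet A) (hμA : μ A ≠ ∞) {B : ι → Set (C0 T)}
    (hB : ∀ i, MeasurableSet (B i)) {g : (ι → ℝ≥0∞) → ℝ≥0∞} (hg : Measurable g) :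
    ∫⁻ ω, (Φ ω).toMeasure A * g (fun i => (Φ ω).toMeasure (B i)) ∂Pr =
      ∫⁻ f in A, ∫⁻ ω, g (fun i => ((Φ ω).addDirac f).toMeasure (B i)) ∂Pr ∂μ := by
  classical
  -- Cutting `A` along the signature gives pieces that no `B i` splits.
  let sig : C0 T → Finset ι := fun f => Finset.univ.filter fun i => f ∈ B i
  have hsig : ∀ J, MeasurableSet (sig ⁻¹' {J}) := by
    intro J
    have : sig ⁻¹' {J} = ⋂ i, {f | f ∈ B i ↔ i ∈ J} := by
      ext f
      simp [sig, Finset.ext_iff]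
    rw [this]
    refine MeasurableSet.iInter fun i => ?_
    by_cases hi : i ∈ J
    · simpa [hi] using hB i
    · simp only [hi, iff_false]
      exact (hB i).compl
  have hAJ : ∀ J, MeasurableSet (A ∩ sig ⁻¹' {J}) := fun J => hA.inter (hsig J)
  have hdisj : ∀ J J', J ≠ J' → Disjoint (A ∩ sig ⁻¹' {J}) (A ∩ sig ⁻¹' {J'}) := by
    refine fun J J' hne => disjoint_left.2 fun f hf hf' => hne ?_
    exact (show sig f = J from hf.2).symm.trans hf'.2
  have hcover : A = ⋃ J ∈ (Finset.univ : Finset (Finset ι)), A ∩ sig ⁻¹' {J} := by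
    ext f
    simp
  have h1 : ∀ ω, (Φ ω).toMeasure A = ∑ J, (Φ ω).toMeasure (A ∩ sig ⁻¹' {J}) := by
    intro ω
    rw [← measure_biUnion_finset (fun o _ o' _ h => hdisj _ _ h) (fun o _ => hAJ o), ← hcover]
  have hcm : Measurable fun ω => g (fun i => (Φ ω).toMeasure (B i)) :=
    hg.comp (measurable_pi_lambda _ fun i => hΦ.measurable_count (hB i))
  simp_rw [h1, Finset.sum_mul]
  rw [lintegral_finsetSum (f := fun J ω => (Φ ω).toMeasure (A ∩ sig ⁻¹' {J}) *
    g fun i => (Φ ω).toMeasure (B i)) Finset.univ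
    fun J _ => (hΦ.measurable_count (hAJ J)).mul hcm]
  conv_rhs => rw [hcover]
  rw [lintegral_biUnion_finset (fun o _ o' _ h => hdisj _ _ h) (fun o _ => hAJ o)]
  refine Finset.sum_congr rfl fun J _ => ?_
  rw [hΦ.lintegral_count_mul_of_atom (hAJ J)
    ((measure_mono inter_subset_left).trans_lt hμA.lt_top).ne hB {i | i ∈ J} ?_ ?_ hg]
  -- On a piece of signature `J`, adding `δ_f` raises exactly the counts with index in `J`, so the
  -- inner integral does not depend on `f`.
  · rw [setLIntegral_congr_fun (g := fun _ =>
      ∫⁻ ω, g (fun i => (Φ ω).toMeasure (B i) + {i | i ∈ J}.indicator 1 i) ∂Pr) (hAJ J),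
      lintegral_const, Measure.restrict_apply_univ, mul_comm]
    intro f hf
    have hfJ : ∀ i, f ∈ B i ↔ i ∈ J := fun i => by
      rw [← show sig f = J from hf.2]
      simp [sig]
    simp only [PointMeasure.toMeasure_addDirac, Measure.add_apply]
    congr! 5 with ω i
    rw [Measure.dirac_apply' _ (hB i)]
    by_cases hi : i ∈ J
    · rw [indicator_of_mem ((hfJ i).2 hi), indicator_of_mem (show i ∈ {i | i ∈ J} from hi)]
      rfl
    · rw [indicator_of_notMem (fun h => hi ((hfJ i).1 h)), indicator_of_notMem (s := {i | i ∈ J}) hi]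
  · intro i hi f hf
    have hi' : i ∈ sig f := by rwa [show sig f = J from hf.2]
    simpa [sig] using hi'
  · intro i hi
    refine disjoint_left.2 fun f hf hf' => hi ?_
    have hi' : i ∈ sig f := by simpa [sig] using hf
    rwa [show sig f = J from hf'.2] at hi'

end IsPoissonRandomMeasure

end MaxID

end

/-! ### The Mecke formula -/

noncomputable section

set_option linter.unusedSectionVars false

namespace MaxID

universe u

variable {T : Type u} [MetricSpace T] [CompactSpace T] {Ω : Type*} [MeasurableSpace Ω]
  {Pr : Measure Ω} [IsProbabilityMeasure Pr] {μ : Measure (C0 T)} {Φ : Ω → PointMeasure T}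

namespace PointMeasure

/-- The `σ`-algebra generated by the count of `B`. -/
@[reducible]
def countAlgebra (B : {B : Set (C0 T) // MeasurableSet B}) : MeasurableSpace (PointMeasure T) :=
  MeasurableSpace.comap (fun M : PointMeasure T => M.toMeasure B.1) inferInstance

variable (T) in
/-- The `π`-system of cylinder sets in `M_p(ℂ₀)`. -/
def cylinders : Set (Set (PointMeasure T)) :=
  piiUnionInter (fun B => {s | MeasurableSet[countAlgebra (T := T) B] s}) univ

lemma isPiSystem_cylinders : IsPiSystem (cylinders T) :=
  isPiSystem_piiUnionInter (fun B => {s | MeasurableSet[countAlgebra (T := T) B] s})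
    (fun B => @MeasurableSpace.isPiSystem_measurableSet _ (countAlgebra B)) _

lemma generateFrom_cylinders :
    (inferInstance : MeasurableSpace (PointMeasure T)) = MeasurableSpace.generateFrom (cylinders T) := by
  rw [cylinders, generateFrom_piiUnionInter_measurableSet countAlgebra univ]
  refine le_antisymm ?_ ?_
  · have : @Measurable _ _ (⨆ B ∈ (univ : Set {B : Set (C0 T) // MeasurableSet B}), countAlgebra B)
        inferInstance (id : PointMeasure T → PointMeasure T) := by
      refine @measurable_of_measurable_coe T _ _ _ (_) _ fun A hA => ?_
      rw [measurable_iff_comap_le]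
      exact le_iSup₂_of_le (⟨A, hA⟩ : {B : Set (C0 T) // MeasurableSet B}) (mem_univ _) le_rfl
    rw [measurable_iff_comap_le, MeasurableSpace.comap_id] at this
    exact this
  · exact iSup₂_le fun B _ => (measurable_coe B.2).comap_le

end PointMeasure

namespace IsPoissonRandomMeasure

lemma sigmaFinite (hΦ : IsPoissonRandomMeasure Pr Φ μ) : SigmaFinite μ :=
  hΦ.finiteAway.sigmaFinite

lemma measurable_addDirac (hΦ : IsPoissonRandomMeasure Pr Φ μ) :
    Measurable fun p : C0 T × Ω => (Φ p.2).addDirac p.1 :=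
  PointMeasure.measurable_addDirac.comp ((hΦ.measurable.comp measurable_snd).prodMk measurable_fst)

/-- As functions of `E` both sides are measures, finite because `μ A < ∞`. They agree on cylinders
by `lintegral_count_mul`, and cylinders form a generating `π`-system. -/
lemma lintegral_mecke_rectangle (hΦ : IsPoissonRandomMeasure Pr Φ μ) {A : Set (C0 T)}
    (hA : MeasurableSet A) (hμA : μ A ≠ ∞) {E : Set (PointMeasure T)} (hE : MeasurableSet E) :
    ∫⁻ ω in Φ ⁻¹' E, (Φ ω).toMeasure A ∂Pr =
      ((μ.restrict A).prod Pr) ((fun p : C0 T × Ω => (Φ p.2).addDirac p.1) ⁻¹' E) := by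
  let m1 : Measure (PointMeasure T) := (Pr.withDensity fun ω => (Φ ω).toMeasure A).map Φ
  let m2 : Measure (PointMeasure T) :=
    ((μ.restrict A).prod Pr).map fun p : C0 T × Ω => (Φ p.2).addDirac p.1
  have hfin : IsFiniteMeasure (μ.restrict A) := ⟨by simpa using hμA.lt_top⟩
  have e1 : ∀ E, MeasurableSet E → m1 E = ∫⁻ ω in Φ ⁻¹' E, (Φ ω).toMeasure A ∂Pr := by
    intro E hE
    rw [Measure.map_apply hΦ.measurable hE, withDensity_apply _ (hΦ.measurable hE)]
  have e2 : ∀ E, MeasurableSet E → m2 E =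
      ((μ.restrict A).prod Pr) ((fun p : C0 T × Ω => (Φ p.2).addDirac p.1) ⁻¹' E) := by
    intro E hE
    rw [Measure.map_apply hΦ.measurable_addDirac hE]
  have hcyl : ∀ E ∈ PointMeasure.cylinders T, m2 E = m1 E := by
    intro E hE
    have hEm : MeasurableSet E := by
      have := MeasurableSpace.measurableSet_generateFrom hE
      rwa [← PointMeasure.generateFrom_cylinders] at this
    rw [e1 E hEm, e2 E hEm]
    obtain ⟨I, -, S, hS, rfl⟩ := hE
    have hS' : ∀ B ∈ I, ∃ D, MeasurableSet D ∧
        (fun M : PointMeasure T => M.toMeasure B.1) ⁻¹' D = S B := fun B hB => hS B hB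
    choose! D hD hDS using hS'
    let g : (I → ℝ≥0∞) → ℝ≥0∞ := (⋂ B : I, {v | v B ∈ D B.1}).indicator 1
    have hgm : MeasurableSet (⋂ B : I, {v : I → ℝ≥0∞ | v B ∈ D B.1}) :=
      MeasurableSet.iInter fun B => measurable_pi_apply B (hD B.1 B.2)
    have hg : Measurable g := measurable_one.indicator hgm
    have key : ∀ M : PointMeasure T,
        g (fun B => M.toMeasure B.1.1) = (⋂ B ∈ I, S B).indicator 1 M := by
      intro M
      have : (fun B : I => M.toMeasure B.1.1) ∈ (⋂ B : I, {v : I → ℝ≥0∞ | v B ∈ D B.1}) ↔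
          M ∈ ⋂ B ∈ I, S B := by
        rw [mem_iInter, mem_iInter₂, Subtype.forall]
        refine forall₂_congr fun B hB => ?_
        rw [← hDS B hB]
        rfl
      by_cases h : M ∈ ⋂ B ∈ I, S B
      · rw [indicator_of_mem h]
        exact indicator_of_mem (this.2 h) _
      · rw [indicator_of_notMem h]
        exact indicator_of_notMem (fun h' => h (this.1 h')) _
    have := hΦ.lintegral_count_mul hA hμA (B := fun B : I => B.1.1) (fun B => B.1.2) hg
    simp only [key] at this
    rw [Measure.prod_apply (hΦ.measurable_addDirac hEm), ← lintegral_indicator (hΦ.measurable hEm)]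
    convert this.symm using 2
    · ext f
      have hm : MeasurableSet (Prod.mk f ⁻¹' ((fun p : C0 T × Ω => (Φ p.2).addDirac p.1) ⁻¹'
          ⋂ B ∈ I, S B)) := measurable_prodMk_left (hΦ.measurable_addDirac hEm)
      rw [← lintegral_indicator_one hm]
      rfl
    · ext ω
      by_cases h : Φ ω ∈ ⋂ B ∈ I, S B
      · rw [indicator_of_mem h, indicator_of_mem (s := Φ ⁻¹' _) h]
        simp
      · rw [indicator_of_notMem h, indicator_of_notMem (s := Φ ⁻¹' _) h]
        simp
  have hfin2 : IsFiniteMeasure m2 := by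
    refine ⟨?_⟩
    rw [e2 _ MeasurableSet.univ]
    exact measure_lt_top _ _
  have huniv : m2 univ = m1 univ :=
    hcyl univ ⟨∅, by simp, fun _ => univ, by simp, by simp⟩
  have := ext_of_generate_finite _ PointMeasure.generateFrom_cylinders
    PointMeasure.isPiSystem_cylinders hcyl huniv
  rw [← e1 E hE, ← e2 E hE, this]

/-- The Mecke formula for the Poisson random measure. -/
theorem lintegral_mecke (hΦ : IsPoissonRandomMeasure Pr Φ μ) {F : PointMeasure T × C0 T → ℝ≥0∞}
    (hF : Measurable F) :
    ∫⁻ ω, ∫⁻ f, F (Φ ω, f) ∂(Φ ω).toMeasure ∂Pr =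
      ∫⁻ f, ∫⁻ ω, F ((Φ ω).addDirac f, f) ∂Pr ∂μ := by
  have := hΦ.sigmaFinite
  let ρ₁ : Measure (PointMeasure T × C0 T) := (Pr.map Φ) ⊗ₘ PointMeasure.kernel T
  have hm : Measurable fun p : C0 T × Ω => ((Φ p.2).addDirac p.1, p.1) :=
    hΦ.measurable_addDirac.prodMk measurable_fst
  let ρ₂ : Measure (PointMeasure T × C0 T) :=
    (μ.prod Pr).map fun p : C0 T × Ω => ((Φ p.2).addDirac p.1, p.1)
  have hprob : IsProbabilityMeasure (Pr.map Φ) :=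
    Measure.isProbabilityMeasure_map hΦ.measurable.aemeasurable
  have hrect : ∀ {E : Set (PointMeasure T)} {A : Set (C0 T)}, MeasurableSet E → MeasurableSet A →
      μ A ≠ ∞ → ρ₂ (E ×ˢ A) = ρ₁ (E ×ˢ A) := by
    intro E A hE hA hμA
    rw [Measure.compProd_apply_prod hE hA, Measure.map_apply hm (hE.prod hA),
      setLIntegral_map hE (Kernel.measurable_coe _ hA) hΦ.measurable]
    refine Eq.trans ?_ (hΦ.lintegral_mecke_rectangle hA hμA hE).symm
    rw [← Measure.restrict_univ (μ := Pr), Measure.prod_restrict, Measure.restrict_univ,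
      Measure.restrict_apply (hΦ.measurable_addDirac hE)]
    congr 1
    ext p
    simp
  have hρ : ρ₂ = ρ₁ := by
    -- Over one norm level the measures are finite, so agreement on rectangles determines them.
    rw [Measure.ext_iff_of_iUnion_eq_univ (s := fun n => univ ×ˢ normLevel n)
      (by rw [← prod_iUnion, iUnion_normLevel, univ_prod_univ])]
    intro n
    have hn : ρ₂ (univ ×ˢ normLevel n) < ∞ := by
      rw [Measure.map_apply hm (MeasurableSet.univ.prod (measurableSet_normLevel n))]
      refine (measure_mono (t := normLevel n ×ˢ univ) ?_).trans_lt ?_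
      · rintro p ⟨-, hp⟩
        exact ⟨hp, trivial⟩
      · rw [Measure.prod_prod, measure_univ, mul_one]
        exact hΦ.finiteAway.normLevel_lt_top n
    have : IsFiniteMeasure (ρ₂.restrict (univ ×ˢ normLevel n)) := ⟨by simpa using hn⟩
    refine Measure.ext_prod fun {E A} hE hA => ?_
    rw [Measure.restrict_apply (hE.prod hA), Measure.restrict_apply (hE.prod hA), prod_inter_prod,
      hrect (hE.inter MeasurableSet.univ) (hA.inter (measurableSet_normLevel n))
      ((measure_mono inter_subset_right).trans_lt (hΦ.finiteAway.normLevel_lt_top n)).ne]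
  have h1 : ∫⁻ p, F p ∂ρ₁ = ∫⁻ ω, ∫⁻ f, F (Φ ω, f) ∂(Φ ω).toMeasure ∂Pr := by
    rw [Measure.lintegral_compProd hF, lintegral_map hF.lintegral_kernel_prod_right' hΦ.measurable]
    rfl
  have h2 : ∫⁻ p, F p ∂ρ₂ = ∫⁻ f, ∫⁻ ω, F ((Φ ω).addDirac f, f) ∂Pr ∂μ := by
    rw [lintegral_map hF hm, lintegral_prod (fun p : C0 T × Ω => F ((Φ p.2).addDirac p.1, p.1))
      (hF.comp hm).aemeasurable]
  rw [← h1, ← h2, hρ]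

end IsPoissonRandomMeasure

end MaxID

end

/-! ### The multivariate Mecke formula off the diagonals -/

noncomputable section

set_option linter.unusedSectionVars false

lemma lintegral_pi_fin_succ {X : Type*} [MeasurableSpace X] (m : Measure X) [SigmaFinite m] (n : ℕ)
    {G : (Fin (n + 1) → X) → ℝ≥0∞} (hG : Measurable G) :
    ∫⁻ x, G x ∂Measure.pi (fun _ => m) =
      ∫⁻ a, ∫⁻ x, G (Fin.cons a x) ∂Measure.pi (fun _ : Fin n => m) ∂m := by
  have h := (measurePreserving_piFinSuccAbove (fun _ : Fin (n + 1) => m) 0).symm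
  rw [← h.lintegral_comp hG, lintegral_prod]
  · simp only [MeasurableEquiv.piFinSuccAbove_symm_apply, Fin.insertNthEquiv, Equiv.coe_fn_mk,
      Fin.insertNth_zero']
  · exact (hG.comp h.measurable).aemeasurable

lemma lintegral_pi_fin_zero {X : Type*} [MeasurableSpace X] (m : Measure X)
    (G : (Fin 0 → X) → ℝ≥0∞) : ∫⁻ x, G x ∂Measure.pi (fun _ => m) = G Fin.elim0 := by
  rw [Measure.pi_of_empty (fun _ : Fin 0 => m) Fin.elim0, lintegral_dirac]

lemma measurable_fin_cons {X : Type*} [MeasurableSpace X] (n : ℕ) :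
    Measurable fun p : X × (Fin n → X) => (Fin.cons p.1 p.2 : Fin (n + 1) → X) := by
  refine measurable_pi_lambda _ fun i => ?_
  induction i using Fin.cases with
  | zero => exact measurable_fst
  | succ i => exact (measurable_pi_apply i).comp measurable_snd

lemma lintegral_pi_reindex {X ι ι' : Type*} [Fintype ι] [Fintype ι'] [MeasurableSpace X]
    (m : Measure X) [SigmaFinite m] (e : ι ≃ ι') {G : (ι → X) → ℝ≥0∞} (hG : Measurable G) :
    ∫⁻ x, G x ∂Measure.pi (fun _ => m) = ∫⁻ y, G (y ∘ e) ∂Measure.pi (fun _ : ι' => m) := by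
  have h := measurePreserving_piCongrLeft (fun _ : ι => m) e.symm
  rw [← h.lintegral_comp hG]
  congr! 3 with y
  ext i
  simp [MeasurableEquiv.coe_piCongrLeft, Equiv.piCongrLeft_apply]

namespace MaxID

universe u

variable {T : Type u} [MetricSpace T] [CompactSpace T] {Ω : Type*} [MeasurableSpace Ω]
  {Pr : Measure Ω} [IsProbabilityMeasure Pr] {μ : Measure (C0 T)} {Φ : Ω → PointMeasure T}

namespace PointMeasure

/-- The induction peels off one coordinate and moves it into the parameter, so the parameter space
`α` must be quantified inside the induction. -/
lemma measurable_lintegral_pi (n : ℕ) : ∀ {α : Type u} [MeasurableSpace α]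
    {F : (α × PointMeasure T) × (Fin n → C0 T) → ℝ≥0∞}, Measurable F →
    Measurable fun p : α × PointMeasure T =>
      ∫⁻ x, F (p, x) ∂Measure.pi (fun _ : Fin n => p.2.toMeasure) := by
  induction n with
  | zero =>
    intro α _ F hF
    simp only [lintegral_pi_fin_zero]
    exact hF.comp (measurable_id.prodMk measurable_const)
  | succ n ih =>
    intro α _ F hF
    let κ : Kernel (α × PointMeasure T) (C0 T) := (kernel T).comap Prod.snd measurable_snd
    have h1 : ∀ p : α × PointMeasure T,
        ∫⁻ x, F (p, x) ∂Measure.pi (fun _ : Fin (n + 1) => p.2.toMeasure) =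
        ∫⁻ f, ∫⁻ x, F (p, Fin.cons f x) ∂Measure.pi (fun _ : Fin n => p.2.toMeasure)
          ∂(κ p) := fun p =>
      lintegral_pi_fin_succ p.2.toMeasure n (hF.comp measurable_prodMk_left)
    simp only [h1]
    refine Measurable.lintegral_kernel_prod_right'
      (f := fun q : (α × PointMeasure T) × C0 T =>
        ∫⁻ x, F (q.1, Fin.cons q.2 x) ∂Measure.pi (fun _ : Fin n => q.1.2.toMeasure)) ?_
    have h2 : Measurable fun r : ((α × C0 T) × PointMeasure T) × (Fin n → C0 T) =>
        F ((r.1.1.1, r.1.2), Fin.cons r.1.1.2 r.2) := by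
      refine hF.comp (Measurable.prodMk (by fun_prop) ?_)
      exact (measurable_fin_cons n).comp
        ((measurable_snd.comp (measurable_fst.comp measurable_fst)).prodMk measurable_snd)
    have h3 := ih h2
    exact h3.comp (g := fun p : (α × C0 T) × PointMeasure T => ∫⁻ x, F ((p.1.1, p.2), Fin.cons p.1.2 x)
        ∂Measure.pi (fun _ : Fin n => p.2.toMeasure))
      (f := fun q : (α × PointMeasure T) × C0 T => ((q.1.1, q.2), q.1.2)) (by fun_prop)

lemma addDirac_addDiracs (M : PointMeasure T) (f : C0 T) {n : ℕ} (x : Fin n → C0 T) :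
    (M.addDiracs x).addDirac f = M.addDiracs (Fin.cons f x : Fin (n + 1) → C0 T) := by
  refine Subtype.ext ?_
  change M.toMeasure + ∑ i, Measure.dirac (x i) + Measure.dirac f =
    M.toMeasure + ∑ i, Measure.dirac ((Fin.cons f x : Fin (n + 1) → C0 T) i)
  rw [Fin.sum_univ_succ]
  simp only [Fin.cons_zero, Fin.cons_succ]
  rw [add_assoc, add_comm (∑ i, Measure.dirac (x i))]

/-- Adding `δ_f` does not change the integral of functions vanishing when a coordinate is `f`. -/
lemma lintegral_pi_addDirac (M : PointMeasure T) (f : C0 T) {n : ℕ} {H : (Fin n → C0 T) → ℝ≥0∞}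
    (h0 : ∀ x i, x i = f → H x = 0) :
    ∫⁻ x, H x ∂Measure.pi (fun _ => (M.addDirac f).toMeasure) =
      ∫⁻ x, H x ∂Measure.pi (fun _ => M.toMeasure) := by
  -- `H` lives on tuples avoiding `f`, and `M` and `M + δ_f` agree off `{f}`.
  have hres : ∀ M' : PointMeasure T, ∫⁻ x, H x ∂Measure.pi (fun _ => M'.toMeasure) =
      ∫⁻ x, H x ∂Measure.pi (fun _ => M'.toMeasure.restrict {f}ᶜ) := by
    intro M'
    rw [← Measure.restrict_pi_pi (fun _ => M'.toMeasure) (fun _ => {f}ᶜ),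
      ← lintegral_indicator (MeasurableSet.univ_pi fun _ => (measurableSet_singleton f).compl)]
    congr 1
    ext x
    by_cases hx : x ∈ univ.pi fun _ => ({f}ᶜ : Set (C0 T))
    · rw [indicator_of_mem hx]
    · rw [indicator_of_notMem hx]
      rw [mem_univ_pi, not_forall] at hx
      obtain ⟨i, hi⟩ := hx
      exact h0 x i (not_not.1 hi)
  rw [hres, hres M]
  have : (M.addDirac f).toMeasure.restrict {f}ᶜ = M.toMeasure.restrict {f}ᶜ := by
    ext A hA
    have hA' := hA.inter (measurableSet_singleton f).compl
    rw [Measure.restrict_apply hA, Measure.restrict_apply hA, toMeasure_addDirac,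
      Measure.add_apply, Measure.dirac_apply' _ hA', indicator_of_notMem, add_zero]
    exact fun h => h.2 rfl
  rw [this]

end PointMeasure

namespace IsPoissonRandomMeasure

/-- The multivariate Mecke formula, for functions vanishing on the diagonals. -/
theorem lintegral_mecke_fin (hΦ : IsPoissonRandomMeasure Pr Φ μ) (n : ℕ) :
    ∀ {F : PointMeasure T × (Fin n → C0 T) → ℝ≥0∞}, Measurable F →
    (∀ M x, ¬ Function.Injective x → F (M, x) = 0) →
    ∫⁻ ω, ∫⁻ x, F (Φ ω, x) ∂Measure.pi (fun _ => (Φ ω).toMeasure) ∂Pr =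
      ∫⁻ x, ∫⁻ ω, F ((Φ ω).addDiracs x, x) ∂Pr ∂Measure.pi (fun _ => μ) := by
  have := hΦ.sigmaFinite
  induction n with
  | zero =>
    intro F hF _
    simp only [lintegral_pi_fin_zero]
    congr! 4 with ω
    refine Subtype.ext ?_
    change (Φ ω).toMeasure = (Φ ω).toMeasure + ∑ i, Measure.dirac _
    simp
  | succ n ih =>
    intro F hF h0
    have hcons : Measurable fun q : (C0 T × PointMeasure T) × (Fin n → C0 T) =>
        F (q.1.2, Fin.cons q.1.1 q.2) :=
      hF.comp ((measurable_snd.comp measurable_fst).prodMk ((measurable_fin_cons n).comp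
        ((measurable_fst.comp measurable_fst).prodMk measurable_snd)))
    have hG := PointMeasure.measurable_lintegral_pi n hcons
    have e1 : ∀ ω, ∫⁻ x, F (Φ ω, x) ∂Measure.pi (fun _ => (Φ ω).toMeasure) =
        ∫⁻ f, ∫⁻ x, F (Φ ω, Fin.cons f x) ∂Measure.pi (fun _ : Fin n => (Φ ω).toMeasure)
          ∂(Φ ω).toMeasure := fun ω =>
      lintegral_pi_fin_succ _ n (hF.comp measurable_prodMk_left)
    simp only [e1]
    rw [hΦ.lintegral_mecke (F := fun p => ∫⁻ x, F (p.1, Fin.cons p.2 x)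
      ∂Measure.pi (fun _ : Fin n => p.1.toMeasure)) (hG.comp measurable_swap)]
    have hmF : Measurable fun p : (Fin (n + 1) → C0 T) × Ω => F ((Φ p.2).addDiracs p.1, p.1) :=
      hF.comp ((PointMeasure.measurable_addDiracs.comp
        ((hΦ.measurable.comp measurable_snd).prodMk measurable_fst)).prodMk measurable_fst)
    rw [lintegral_pi_fin_succ μ n hmF.lintegral_prod_right']
    congr 1
    ext f
    -- After the one-variable formula the other coordinates are integrated against `Φ + δ_f`. The
    -- extra mass only charges tuples that repeat `f`, where `F` vanishes.
    have e2 : ∀ ω, ∫⁻ x, F ((Φ ω).addDirac f, Fin.cons f x)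
        ∂Measure.pi (fun _ : Fin n => ((Φ ω).addDirac f).toMeasure) =
        ∫⁻ x, F ((Φ ω).addDirac f, Fin.cons f x)
        ∂Measure.pi (fun _ : Fin n => (Φ ω).toMeasure) := by
      intro ω
      refine PointMeasure.lintegral_pi_addDirac _ _ fun x i hi => h0 _ _ fun hinj => ?_
      have := @hinj 0 i.succ (by simp [hi])
      exact (Fin.succ_ne_zero i) this.symm
    simp only [e2]
    rw [ih (F := fun p => F (p.1.addDirac f, Fin.cons f p.2))]
    · simp only [PointMeasure.addDirac_addDiracs]
    · refine hF.comp (Measurable.prodMk ?_ ?_)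
      · exact PointMeasure.measurable_addDirac.comp (measurable_fst.prodMk measurable_const)
      · exact (measurable_fin_cons n).comp (measurable_const.prodMk measurable_snd)
    · intro M x hx
      refine h0 _ _ fun hinj => hx ?_
      exact (Fin.cons_injective_iff.1 hinj).2

theorem lintegral_mecke_pi (hΦ : IsPoissonRandomMeasure Pr Φ μ) {ι : Type*} [Fintype ι]
    {F : PointMeasure T × (ι → C0 T) → ℝ≥0∞} (hF : Measurable F)
    (h0 : ∀ M x, ¬ Function.Injective x → F (M, x) = 0) :
    ∫⁻ ω, ∫⁻ x, F (Φ ω, x) ∂Measure.pi (fun _ => (Φ ω).toMeasure) ∂Pr =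
      ∫⁻ x, ∫⁻ ω, F ((Φ ω).addDiracs x, x) ∂Pr ∂Measure.pi (fun _ => μ) := by
  have := hΦ.sigmaFinite
  let e := Fintype.equivFin ι
  have hmF : Measurable fun p : (ι → C0 T) × Ω => F ((Φ p.2).addDiracs p.1, p.1) :=
    hF.comp ((PointMeasure.measurable_addDiracs.comp
      ((hΦ.measurable.comp measurable_snd).prodMk measurable_fst)).prodMk measurable_fst)
  rw [lintegral_pi_reindex μ e hmF.lintegral_prod_right']
  have e1 : ∀ ω, ∫⁻ x, F (Φ ω, x) ∂Measure.pi (fun _ => (Φ ω).toMeasure) =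
      ∫⁻ y, F (Φ ω, y ∘ e) ∂Measure.pi (fun _ => (Φ ω).toMeasure) := fun ω =>
    lintegral_pi_reindex _ e (hF.comp measurable_prodMk_left)
  simp only [e1]
  have hcomp : Measurable fun y : Fin (Fintype.card ι) → C0 T => y ∘ e :=
    measurable_pi_lambda _ fun i => measurable_pi_apply (e i)
  rw [hΦ.lintegral_mecke_fin _ (F := fun p => F (p.1, p.2 ∘ e))]
  · congr! 6 with y ω
    refine Subtype.ext ?_
    change (Φ ω).toMeasure + ∑ i, Measure.dirac (y i) =
      (Φ ω).toMeasure + ∑ i, Measure.dirac (y (e i))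
    rw [Equiv.sum_comp e fun i => Measure.dirac (y i)]
  · exact hF.comp (measurable_fst.prodMk (hcomp.comp measurable_snd))
  · intro M y hy
    refine h0 _ _ fun hinj => hy ?_
    have := hinj.comp e.symm.injective
    simpa [Function.comp_assoc] using this

end IsPoissonRandomMeasure

end MaxID

end

/-! ### Extremal functions and the hitting scenario -/

noncomputable section

set_option linter.unusedSectionVars false

namespace MaxID

universe u

variable {T : Type u} [MetricSpace T] [CompactSpace T] {Ω : Type*} [MeasurableSpace Ω]
  {Pr : Measure Ω} [IsProbabilityMeasure Pr] {μ : Measure (C0 T)} {Φ : Ω → PointMeasure T}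

/-- The set of functions that reach the maximum of `M` at `s`. -/
def extremalSet (M : Measure (C0 T)) (s : T) : Set (C0 T) := {f | maxFun M s ≤ f s}

lemma measurableSet_extremalSet (M : Measure (C0 T)) (s : T) : MeasurableSet (extremalSet M s) :=
  measurableSet_le measurable_const (C0.measurable_eval s)

lemma extremalPart_singleton (M : Measure (C0 T)) (s : T) :
    extremalPart {s} M = M.restrict (extremalSet M s) := by
  rw [extremalPart]
  congr 1
  ext f
  simp [LtOn, extremalSet]

lemma extremalFun_eq_some_iff {M : Measure (C0 T)} {s : T} {f : C0 T} :
    extremalFun M s = some f ↔ M.restrict (extremalSet M s) = Measure.dirac f := by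
  rw [← extremalPart_singleton, extremalFun]
  split_ifs with h
  · have h1 := h.choose_spec
    constructor
    · intro h2
      rw [← Option.some_inj.1 h2]
      exact h1
    · intro h2
      rw [h1] at h2
      exact congrArg some (dirac_eq_dirac_iff.1 h2)
  · simp only [false_iff]
    exact fun h2 => h ⟨f, h2⟩

namespace IsPointMeasure

variable {M : Measure (C0 T)}

lemma extremalFun_eq_none_iff (h : IsPointMeasure M) {s : T} :
    extremalFun M s = none ↔ M (extremalSet M s) ≠ 1 := by
  rw [Option.eq_none_iff_forall_ne_some, Ne,
    ← h.exists_restrict_eq_dirac_iff (measurableSet_extremalSet M s), not_exists]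
  exact forall_congr' fun f => not_congr extremalFun_eq_some_iff

/-- Two extremal sets of mass one carry the same atom exactly when their intersection is charged.
Only masses appear on the right, which gives measurability; the first alternative is the class of
undefined extremal functions. -/
lemma extremalFun_eq_iff (h : IsPointMeasure M) {s s' : T} :
    extremalFun M s = extremalFun M s' ↔
      (M (extremalSet M s) ≠ 1 ∧ M (extremalSet M s') ≠ 1) ∨
      (M (extremalSet M s) = 1 ∧ M (extremalSet M s') = 1 ∧
        M {f | f ∈ extremalSet M s ∧ f ∈ extremalSet M s'} ≠ 0) := by
  have hm := measurableSet_extremalSet M s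
  have hm' := measurableSet_extremalSet M s'
  by_cases h1 : M (extremalSet M s) = 1
  · by_cases h2 : M (extremalSet M s') = 1
    · simp only [h1, h2, ne_eq, not_true_eq_false, and_self, true_and, false_or]
      obtain ⟨f, hf⟩ := (h.exists_restrict_eq_dirac_iff hm).2 h1
      obtain ⟨f', hf'⟩ := (h.exists_restrict_eq_dirac_iff hm').2 h2
      rw [extremalFun_eq_some_iff.2 hf, extremalFun_eq_some_iff.2 hf', Option.some_inj]
      have e1 : M {f | f ∈ extremalSet M s ∧ f ∈ extremalSet M s'} =
          Measure.dirac f (extremalSet M s') := by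
        rw [← hf, Measure.restrict_apply hm', inter_comm]
        rfl
      have e2 : f' ∈ extremalSet M s' := by
        by_contra hn
        have : M.restrict (extremalSet M s') (extremalSet M s') = 0 := by
          rw [hf', Measure.dirac_apply' _ hm', indicator_of_notMem hn]
        rw [Measure.restrict_apply_self, h2] at this
        exact one_ne_zero this
      rw [e1, Measure.dirac_apply' _ hm']
      constructor
      · rintro rfl
        rw [indicator_of_mem e2]
        simp
      · intro h3
        have hfs' : f ∈ extremalSet M s' := by_contra fun hn => h3 (indicator_of_notMem hn _)
        have hat : f ∈ atoms M := by
          have : M.restrict (extremalSet M s) {f} = 1 := by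
            rw [hf, Measure.dirac_apply' _ (measurableSet_singleton f),
              indicator_of_mem (mem_singleton f), Pi.one_apply]
          intro h0
          have h4 := Measure.restrict_le_self (μ := M) (s := extremalSet M s) {f}
          rw [this, h0] at h4
          exact absurd h4 (by simp)
        have := h.restrict_eq_dirac h2 hat hfs'
        rw [hf'] at this
        exact (dirac_eq_dirac_iff.1 this).symm
    · have e2 := h.extremalFun_eq_none_iff.2 h2
      simp only [h1, h2, ne_eq, not_true_eq_false, false_and, and_false, or_self, iff_false, e2]
      exact fun h3 => h.extremalFun_eq_none_iff.1 h3 h1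
  · have e1 := h.extremalFun_eq_none_iff.2 h1
    simp only [h1, ne_eq, not_false_eq_true, true_and, false_and, or_false, e1]
    rw [eq_comm]
    exact h.extremalFun_eq_none_iff

end IsPointMeasure

lemma PointMeasure.measurableSet_extremalFun_eq (s s' : T) :
    MeasurableSet {M : PointMeasure T |
      extremalFun M.toMeasure s = extremalFun M.toMeasure s'} := by
  have hS : ∀ s : T, MeasurableSet {q : (Unit × PointMeasure T) × C0 T |
      maxFun q.1.2.toMeasure s ≤ q.2 s} := fun s =>
    measurableSet_le ((measurable_maxFun s).comp (measurable_snd.comp measurable_fst))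
      ((C0.measurable_eval s).comp measurable_snd)
  have h1 : ∀ s : T, Measurable fun M : PointMeasure T =>
      M.toMeasure (extremalSet M.toMeasure s) := fun s =>
    (measurable_measure_prodMk (hS s)).comp (measurable_prodMk_left (x := ()))
  have h2 : Measurable fun M : PointMeasure T => M.toMeasure
      {f | f ∈ extremalSet M.toMeasure s ∧ f ∈ extremalSet M.toMeasure s'} :=
    (measurable_measure_prodMk ((hS s).inter (hS s'))).comp (measurable_prodMk_left (x := ()))
  have e1 := fun s => h1 s (measurableSet_singleton 1)
  have e2 := h2 (measurableSet_singleton 0)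
  have : {M : PointMeasure T | extremalFun M.toMeasure s = extremalFun M.toMeasure s'} =
      {M | (M.toMeasure (extremalSet M.toMeasure s) ≠ 1 ∧
          M.toMeasure (extremalSet M.toMeasure s') ≠ 1) ∨
        (M.toMeasure (extremalSet M.toMeasure s) = 1 ∧
          M.toMeasure (extremalSet M.toMeasure s') = 1 ∧ M.toMeasure
            {f | f ∈ extremalSet M.toMeasure s ∧ f ∈ extremalSet M.toMeasure s'} ≠ 0)} := by
    ext M
    exact M.isPointMeasure.extremalFun_eq_iff
  rw [this]
  exact ((e1 s).compl.inter (e1 s').compl).union ((e1 s).inter ((e1 s').inter e2.compl))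

section HittingScenario

variable [DecidableEq T]

/-- A partition is determined by the blocks of its points, so the scenario event reduces to finitely
many coincidences of extremal functions. -/
lemma hittingScenario_eq_iff {K : Finset T} {M : Measure (C0 T)} {τ : Finpartition K} :
    hittingScenario K M = τ ↔
      ∀ a ∈ K, ∀ b ∈ K, (b ∈ τ.part a ↔ extremalFun M a = extremalFun M b) := by
  classical
  have hiff : ∀ a ∈ K, ∀ b ∈ K, (b ∈ (hittingScenario K M).part a ↔
      extremalFun M a = extremalFun M b) := by
    intro a ha b hb
    rw [hittingScenario, Finpartition.mem_part_ofSetSetoid_iff_rel]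
    simp only [ha, hb, true_and]
    rfl
  constructor
  · rintro rfl
    exact hiff
  · intro h
    have hpart : ∀ a ∈ K, (hittingScenario K M).part a = τ.part a := by
      intro a ha
      ext b
      by_cases hb : b ∈ K
      · rw [hiff a ha b hb, h a ha b hb]
      · exact iff_of_false (fun h' => hb (Finpartition.part_subset _ _ h'))
          (fun h' => hb (Finpartition.part_subset _ _ h'))
    have hparts : ∀ σ : Finpartition K, σ.parts = K.image σ.part := by
      intro σ
      ext L
      rw [Finset.mem_image]
      constructor
      · intro hL
        obtain ⟨a, ha⟩ := σ.nonempty_of_mem_parts hL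
        exact ⟨a, σ.le hL ha, σ.part_eq_of_mem hL ha⟩
      · rintro ⟨a, ha, rfl⟩
        exact σ.part_mem.2 ha
    refine Finpartition.ext ?_
    rw [hparts, hparts τ]
    exact Finset.image_congr fun a ha => hpart a ha

lemma measurableSet_hittingScenario_eq {K : Finset T} (τ : Finpartition K) :
    MeasurableSet {M : PointMeasure T | hittingScenario K M.toMeasure = τ} := by
  simp only [hittingScenario_eq_iff]
  have : {M : PointMeasure T | ∀ a ∈ K, ∀ b ∈ K, (b ∈ τ.part a ↔
      extremalFun M.toMeasure a = extremalFun M.toMeasure b)} =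
      ⋂ a ∈ K, ⋂ b ∈ K, {M | b ∈ τ.part a ↔
      extremalFun M.toMeasure a = extremalFun M.toMeasure b} := by
    ext M
    simp only [mem_iInter]
    rfl
  rw [this]
  refine Finset.measurableSet_biInter _ fun a _ => Finset.measurableSet_biInter _ fun b _ => ?_
  have h := PointMeasure.measurableSet_extremalFun_eq a b
  by_cases hb : b ∈ τ.part a
  · simpa only [hb, true_iff] using h
  · simp only [hb, false_iff]
    exact h.compl

lemma map_eq_sum_scenarioLaw (hΦ : Measurable Φ) {η : Ω → T → ℝ} {k : ℕ} {t : Fin k → T}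
    (hη : Measurable fun ω i => η ω (t i)) :
    Pr.map (fun ω i => η ω (t i)) = ∑ τ : Finpartition (pts t), scenarioLaw Pr Φ η t τ := by
  have hτ : ∀ τ : Finpartition (pts t),
      MeasurableSet {ω | hittingScenario (pts t) (Φ ω).1 = τ} := fun τ =>
    hΦ (measurableSet_hittingScenario_eq τ)
  ext C hC
  rw [Measure.coe_finsetSum, Finset.sum_apply, Measure.map_apply hη hC]
  simp only [scenarioLaw]
  have e : ∀ τ : Finpartition (pts t), ((Pr.restrict {ω | hittingScenario (pts t) (Φ ω).1 = τ}).map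
      (fun ω i => η ω (t i))) C = Pr ((fun ω i => η ω (t i)) ⁻¹' C ∩
        {ω | hittingScenario (pts t) (Φ ω).1 = τ}) := fun τ => by
    rw [Measure.map_apply hη hC, Measure.restrict_apply (hη hC)]
  simp only [e]
  rw [← measure_biUnion_finset _ fun τ _ => (hη hC).inter (hτ τ)]
  · congr 1
    ext ω
    simp
  · intro τ _ τ' _ hne
    refine disjoint_left.2 fun ω h h' => hne ?_
    exact (show hittingScenario (pts t) (Φ ω).1 = τ from h.2).symm.trans h'.2

end HittingScenario

/-! ### Almost sure existence of the extremal functions -/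

section Existence

variable {s : T}

lemma measure_pos_eq_top (h : Tendsto (tailAt μ s) (𝓝[>] 0) (𝓝 ∞)) : μ {f | 0 < f s} = ∞ := by
  refine top_le_iff.1 (le_of_tendsto h ?_)
  filter_upwards [self_mem_nhdsWithin] with x hx
  exact measure_mono fun f hf => show 0 < f s from lt_of_lt_of_le (show 0 < x from hx) hf

/-- An atom of the marginal at `x` would be a jump of the tail function. Finiteness of the tail at
`x > 0` permits the cancellation. -/
lemma measure_eval_eq_zero (hμ : FiniteAway μ) (h : ContinuousOn (tailAt μ s) (Ioi 0)) {x : ℝ}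
    (hx : 0 < x) : μ {f | f s = x} = 0 := by
  have hfin : tailAt μ s x < ∞ := hμ.le_eval_lt_top s hx
  have hle : ∀ y, x < y → μ {f | f s = x} + tailAt μ s y ≤ tailAt μ s x := by
    intro y hy
    rw [tailAt, tailAt, ← measure_union _ (measurableSet_le measurable_const (C0.measurable_eval s))]
    · refine measure_mono ?_
      rintro f (hf | hf)
      · exact (show f s = x from hf).ge
      · exact hy.le.trans hf
    · refine disjoint_left.2 fun f hf hf' => ?_
      have h1 : f s = x := hf
      have h2 : y ≤ f s := hf'
      linarith
  have hlim : Tendsto (fun y => μ {f | f s = x} + tailAt μ s y) (𝓝[>] x)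
      (𝓝 (μ {f | f s = x} + tailAt μ s x)) :=
    tendsto_const_nhds.add ((h.continuousAt (Ioi_mem_nhds hx)).tendsto.mono_left nhdsWithin_le_nhds)
  have h1 := le_of_tendsto hlim (by filter_upwards [self_mem_nhdsWithin] with y hy using hle y hy)
  have h2 : μ {f | f s = x} + tailAt μ s x ≤ 0 + tailAt μ s x := by rwa [zero_add]
  exact le_zero_iff.1 ((ENNReal.add_le_add_iff_right hfin.ne).1 h2)

namespace IsPoissonRandomMeasure

lemma ae_maxFun_pos (hΦ : IsPoissonRandomMeasure Pr Φ μ)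
    (h : Tendsto (tailAt μ s) (𝓝[>] 0) (𝓝 ∞)) : ∀ᵐ ω ∂Pr, 0 < maxFun (Φ ω).toMeasure s := by
  have hm : MeasurableSet {f : C0 T | 0 < f s} :=
    measurableSet_lt measurable_const (C0.measurable_eval s)
  filter_upwards [hΦ.ae_count_eq_top hm (measure_pos_eq_top h)] with ω hω
  obtain ⟨f, hf, hf0⟩ := ((Φ ω).isPointMeasure.measure_ne_zero_iff hm).1
    (by rw [hω]; exact ENNReal.top_ne_zero)
  exact lt_of_lt_of_le hf0 ((Φ ω).isPointMeasure.le_maxFun hf s)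

/-- By the Mecke formula, the expected number of atoms in a tie is the `μ`-integral over `f` of the
probability that `Φ` charges `{g | g s = f s}`. That set is `μ`-null when `f s > 0`. -/
lemma ae_no_ties (hΦ : IsPoissonRandomMeasure Pr Φ μ) (h : ContinuousOn (tailAt μ s) (Ioi 0)) :
    ∀ᵐ ω ∂Pr, ∀ f ∈ atoms (Φ ω).toMeasure, 0 < f s → (Φ ω).toMeasure {g | g s = f s} = 1 := by
  let S : Set (PointMeasure T × C0 T) := {p | 0 < p.2 s ∧ p.1.toMeasure {g | g s = p.2 s} ≠ 1}
  have hcount : Measurable fun p : PointMeasure T × C0 T => p.1.toMeasure {g | g s = p.2 s} := by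
    have : MeasurableSet {q : (C0 T × PointMeasure T) × C0 T | q.2 s = q.1.1 s} :=
      measurableSet_eq_fun ((C0.measurable_eval s).comp measurable_snd)
        ((C0.measurable_eval s).comp (measurable_fst.comp measurable_fst))
    exact (PointMeasure.measurable_measure_prodMk this).comp measurable_swap
  have hS : MeasurableSet S :=
    (measurableSet_lt measurable_const ((C0.measurable_eval s).comp measurable_snd)).inter
      (hcount (measurableSet_singleton 1)).compl
  have hind : Measurable (S.indicator (1 : PointMeasure T × C0 T → ℝ≥0∞)) :=
    measurable_one.indicator hS
  have key := hΦ.lintegral_mecke hind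
  have hzero : ∀ f : C0 T, ∫⁻ ω, S.indicator 1 ((Φ ω).addDirac f, f) ∂Pr = 0 := by
    intro f
    have hm : MeasurableSet {g : C0 T | g s = f s} :=
      measurableSet_eq_fun (C0.measurable_eval s) measurable_const
    by_cases hf : 0 < f s
    · have h1 : Pr {ω | (Φ ω).toMeasure {g | g s = f s} = 0} = 1 := by
        rw [hΦ.measure_count_eq_zero hm, measure_eval_eq_zero hΦ.finiteAway h hf]
        simp
      have h2 : ∀ᵐ ω ∂Pr, (Φ ω).toMeasure {g | g s = f s} = 0 :=
        (prob_compl_eq_zero_iff (hΦ.measurable_count hm (measurableSet_singleton 0))).2 h1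
      rw [lintegral_eq_zero_iff' ?_]
      · filter_upwards [h2] with ω hω
        refine indicator_of_notMem (fun hS => hS.2 ?_) _
        rw [PointMeasure.toMeasure_addDirac, Measure.add_apply, hω, Measure.dirac_apply' _ hm,
          indicator_of_mem (show f ∈ {g : C0 T | g s = f s} from rfl), zero_add, Pi.one_apply]
      · refine (hind.comp (Measurable.prodMk ?_ measurable_const)).aemeasurable
        exact hΦ.measurable_addDirac.comp measurable_prodMk_left
    · have : ∀ ω, S.indicator (1 : PointMeasure T × C0 T → ℝ≥0∞) ((Φ ω).addDirac f, f) = 0 :=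
        fun ω => indicator_of_notMem (fun hS => hf hS.1) _
      simp [this]
  simp only [hzero, lintegral_zero] at key
  have hmint : Measurable fun ω => ∫⁻ f, S.indicator 1 (Φ ω, f) ∂(Φ ω).toMeasure :=
    (hind.lintegral_kernel_prod_right' (κ := PointMeasure.kernel T)).comp hΦ.measurable
  rw [lintegral_eq_zero_iff hmint] at key
  filter_upwards [key] with ω hω f hf hfs
  by_contra hne
  have h1 := (lintegral_eq_zero_iff (hind.comp measurable_prodMk_left)).1 hω
  have h2 : (Φ ω).toMeasure {f | S.indicator (1 : PointMeasure T × C0 T → ℝ≥0∞) (Φ ω, f) ≠ 0} = 0 := h1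
  refine hf (measure_mono_null (singleton_subset_iff.2 ?_) h2)
  change S.indicator (1 : PointMeasure T × C0 T → ℝ≥0∞) (Φ ω, f) ≠ 0
  rw [indicator_of_mem (show (Φ ω, f) ∈ S from ⟨hfs, hne⟩)]
  simp

lemma ae_extremal_exists (hΦ : IsPoissonRandomMeasure Pr Φ μ)
    (h : ContinuousOn (tailAt μ s) (Ioi 0)) (h' : Tendsto (tailAt μ s) (𝓝[>] 0) (𝓝 ∞)) :
    ∀ᵐ ω ∂Pr, ∃ f, (Φ ω).toMeasure.restrict (extremalSet (Φ ω).toMeasure s) = Measure.dirac f := by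
  filter_upwards [hΦ.ae_maxFun_pos h', hΦ.ae_no_ties h] with ω h1 h2
  have hM := (Φ ω).isPointMeasure
  rw [hM.exists_restrict_eq_dirac_iff (measurableSet_extremalSet _ s)]
  obtain ⟨f, hf, hfs⟩ := hM.exists_atom_eq_maxFun h1
  rw [← h2 f hf (hfs ▸ h1)]
  -- No atom exceeds the maximum, so up to a null set the extremal set is the level set of the
  -- attained value.
  refine measure_congr ?_
  filter_upwards [hM.ae_mem_atoms] with g hg
  have := hM.le_maxFun hg s
  refine propext ⟨fun h3 => ?_, fun h3 => ?_⟩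
  · exact (le_antisymm this h3).trans hfs.symm
  · exact hfs.symm.le.trans (show g s = f s from h3).ge

end IsPoissonRandomMeasure

end Existence

end MaxID

end

/-! ### The law on a scenario as an integral over tuples of functions -/

noncomputable section

set_option linter.unusedSectionVars false

namespace MaxID

universe u

variable {T : Type u} [MetricSpace T] [CompactSpace T] [DecidableEq T] {Ω : Type*}
  [MeasurableSpace Ω] {Pr : Measure Ω} [IsProbabilityMeasure Pr] {μ : Measure (C0 T)}
  {Φ : Ω → PointMeasure T} {k : ℕ} {t : Fin k → T}

section Configuration

variable (t) (τ : Finpartition (pts t))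

lemma mem_pts (i : Fin k) : t i ∈ pts t := Finset.mem_image_of_mem t (Finset.mem_univ i)

/-- The block of the point `t i`. -/
def block (i : Fin k) : τ.parts := ⟨τ.part (t i), τ.part_mem.2 (mem_pts t i)⟩

lemma mem_block (i : Fin k) : t i ∈ (block t τ i).1 := τ.mem_part (mem_pts t i)

lemma mem_iff_block_eq {i : Fin k} {L : τ.parts} : t i ∈ L.1 ↔ block t τ i = L := by
  constructor
  · intro h
    exact Subtype.ext (τ.part_eq_of_mem L.2 h)
  · rintro rfl
    exact mem_block t τ i

lemma exists_block_eq (L : τ.parts) : ∃ i, block t τ i = L := by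
  obtain ⟨a, ha⟩ := τ.nonempty_of_mem_parts L.2
  obtain ⟨i, -, rfl⟩ := Finset.mem_image.1 (τ.le L.2 ha)
  exact ⟨i, (mem_iff_block_eq t τ).1 ha⟩

/-- The vector `y` built from one function for each block. -/
def config (x : τ.parts → C0 T) : Fin k → ℝ := fun i => x (block t τ i) (t i)

/-- The functions of the other blocks are smaller than the function of a block, on this block. -/
def Compatible (x : τ.parts → C0 T) : Prop :=
  ∀ (L : τ.parts) (i : Fin k), t i ∉ L.1 → x L (t i) < config t τ x i

lemma measurable_config : Measurable (config t τ) :=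
  measurable_pi_lambda _ fun i => (C0.measurable_eval (t i)).comp (measurable_pi_apply _)

lemma measurableSet_compatible : MeasurableSet {x | Compatible t τ x} := by
  have : {x | Compatible t τ x} = ⋂ (L : τ.parts) (i : Fin k),
      {x | t i ∉ L.1 → x L (t i) < config t τ x i} := by
    ext x
    simp only [mem_iInter]
    rfl
  rw [this]
  refine MeasurableSet.iInter fun L => MeasurableSet.iInter fun i => ?_
  by_cases h : t i ∈ L.1
  · simp [h]
  · simp only [h, not_false_eq_true, forall_const]
    exact measurableSet_lt ((C0.measurable_eval (t i)).comp (measurable_pi_apply L))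
      ((measurable_pi_apply i).comp (measurable_config t τ))

-- Every block contains some `t i`, where the function of any other block is strictly smaller. This
-- keeps compatible tuples off the diagonals, as the multivariate Mecke formula requires.
variable {t τ} in
lemma Compatible.injective {x : τ.parts → C0 T} (h : Compatible t τ x) : Function.Injective x := by
  intro L L' hx
  by_contra hne
  obtain ⟨i, rfl⟩ := exists_block_eq t τ L'
  have := h L i fun hi => hne ((mem_iff_block_eq t τ).1 hi).symm
  rw [hx] at this
  exact lt_irrefl _ this

/-- The event that the functions `x` are the only atoms of `M` reaching the vector `y` that
they build, in a scenario where `y ∈ C` and the hitting scenario is `τ`. -/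
def scenarioSet (C : Set (Fin k → ℝ)) : Set (PointMeasure T × (τ.parts → C0 T)) :=
  {p | config t τ p.2 ∈ C ∧ Compatible t τ p.2 ∧
    ∀ i, p.1.toMeasure {f | config t τ p.2 i ≤ f (t i)} = 1}

lemma measurable_count_config (i : Fin k) : Measurable
    fun p : PointMeasure T × (τ.parts → C0 T) =>
      p.1.toMeasure {f | config t τ p.2 i ≤ f (t i)} := by
  have : MeasurableSet {q : ((τ.parts → C0 T) × PointMeasure T) × C0 T |
      config t τ q.1.1 i ≤ q.2 (t i)} :=
    measurableSet_le ((measurable_pi_apply i).comp ((measurable_config t τ).comp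
      (measurable_fst.comp measurable_fst))) ((C0.measurable_eval (t i)).comp measurable_snd)
  exact (PointMeasure.measurable_measure_prodMk this).comp measurable_swap

lemma measurableSet_scenarioSet {C : Set (Fin k → ℝ)} (hC : MeasurableSet C) :
    MeasurableSet (scenarioSet t τ C) := by
  refine (((measurable_config t τ).comp measurable_snd) hC).inter
    ((measurable_snd (measurableSet_compatible t τ)).inter ?_)
  have : {p : PointMeasure T × (τ.parts → C0 T) |
      ∀ i, p.1.toMeasure {f | config t τ p.2 i ≤ f (t i)} = 1} =
      ⋂ i, {p | p.1.toMeasure {f | config t τ p.2 i ≤ f (t i)} = 1} := by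
    ext p
    simp only [mem_iInter]
    rfl
  change MeasurableSet {p : PointMeasure T × (τ.parts → C0 T) |
      ∀ i, p.1.toMeasure {f | config t τ p.2 i ≤ f (t i)} = 1}
  rw [this]
  exact MeasurableSet.iInter fun i => measurable_count_config t τ i (measurableSet_singleton 1)

-- The unit mass of `{f | y_i ≤ f (t i)}` is already used by the function of the block of `t i`, so
-- no other atom reaches `y_i`. Hence `y` is the maximum and these functions are extremal; being
-- distinct, they induce the partition `τ`.
variable {t τ} in
lemma extremal_of_mem_scenarioSet {C : Set (Fin k → ℝ)} {M : PointMeasure T}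
    {x : τ.parts → C0 T} (hx : ∀ L, x L ∈ atoms M.toMeasure) (h : (M, x) ∈ scenarioSet t τ C) :
    (∀ i, maxFun M.toMeasure (t i) = config t τ x i) ∧
    (∀ i, extremalFun M.toMeasure (t i) = some (x (block t τ i))) ∧
    hittingScenario (pts t) M.toMeasure = τ := by
  obtain ⟨-, hcomp, hone⟩ := h
  have hM := M.isPointMeasure
  have hres : ∀ i, M.toMeasure.restrict {f | config t τ x i ≤ f (t i)} =
      Measure.dirac (x (block t τ i)) := fun i =>
    hM.restrict_eq_dirac (hone i) (hx _) (le_refl (x (block t τ i) (t i)))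
  have hmax : ∀ i, maxFun M.toMeasure (t i) = config t τ x i := by
    intro i
    refine le_antisymm ?_ (hM.le_maxFun (hx (block t τ i)) (t i))
    refine csSup_le ⟨_, x (block t τ i), hx _, rfl⟩ ?_
    rintro z ⟨f, hf, rfl⟩
    by_contra hlt
    have hne : f ≠ x (block t τ i) := by
      rintro rfl
      exact hlt le_rfl
    have h1 : M.toMeasure.restrict {f | config t τ x i ≤ f (t i)} {f} = 0 := by
      rw [hres i, Measure.dirac_apply' _ (measurableSet_singleton f)]
      exact indicator_of_notMem (s := {f}) (fun h => hne (Eq.symm h)) _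
    rw [Measure.restrict_apply (measurableSet_singleton f), inter_eq_self_of_subset_left] at h1
    · exact hf h1
    · exact singleton_subset_iff.2 (not_le.1 hlt).le
  have hext : ∀ i, extremalFun M.toMeasure (t i) = some (x (block t τ i)) := by
    intro i
    rw [extremalFun_eq_some_iff, ← hres i, extremalSet, hmax i]
  refine ⟨hmax, hext, hittingScenario_eq_iff.2 ?_⟩
  intro a ha b hb
  obtain ⟨i, -, rfl⟩ := Finset.mem_image.1 ha
  obtain ⟨j, -, rfl⟩ := Finset.mem_image.1 hb
  rw [hext, hext, Option.some_inj, hcomp.injective.eq_iff]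
  change t j ∈ (block t τ i).1 ↔ _
  rw [mem_iff_block_eq, eq_comm]

variable {t τ} in
lemma mem_scenarioSet_of_extremal {C : Set (Fin k → ℝ)} {M : PointMeasure T}
    {φ : Fin k → C0 T} (hφ : ∀ i, M.toMeasure.restrict (extremalSet M.toMeasure (t i)) =
      Measure.dirac (φ i)) (hτ : hittingScenario (pts t) M.toMeasure = τ)
    (hC : (fun i => maxFun M.toMeasure (t i)) ∈ C) :
    ∃ x : τ.parts → C0 T, (∀ L, M.toMeasure {x L} = 1) ∧ (M, x) ∈ scenarioSet t τ C := by
  have hM := M.isPointMeasure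
  have hext : ∀ i, extremalFun M.toMeasure (t i) = some (φ i) := fun i =>
    extremalFun_eq_some_iff.2 (hφ i)
  have hmem : ∀ i, φ i ∈ extremalSet M.toMeasure (t i) := by
    intro i
    by_contra hn
    have h1 := hφ i ▸ Measure.restrict_apply_self M.toMeasure (extremalSet M.toMeasure (t i))
    have h2 := (hM.exists_restrict_eq_dirac_iff (measurableSet_extremalSet _ (t i))).1 ⟨_, hφ i⟩
    rw [h2, Measure.dirac_apply' _ (measurableSet_extremalSet _ (t i)),
      indicator_of_notMem hn] at h1
    exact zero_ne_one h1
  have hsing : ∀ i (f : C0 T), f ∈ extremalSet M.toMeasure (t i) →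
      M.toMeasure {f} = Measure.dirac (φ i) {f} := by
    intro i f hf
    rw [← hφ i, Measure.restrict_apply (measurableSet_singleton f),
      inter_eq_self_of_subset_left (singleton_subset_iff.2 hf)]
  have hone : ∀ i, M.toMeasure {φ i} = 1 := by
    intro i
    rw [hsing i _ (hmem i)]
    simp
  have hat : ∀ i, φ i ∈ atoms M.toMeasure := fun i => by
    change M.toMeasure {φ i} ≠ 0
    rw [hone i]
    exact one_ne_zero
  have heq : ∀ i, φ i (t i) = maxFun M.toMeasure (t i) := fun i =>
    le_antisymm (hM.le_maxFun (hat i) _) (hmem i)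
  rw [hittingScenario_eq_iff] at hτ
  have hiff : ∀ i j, block t τ i = block t τ j ↔ φ i = φ j := by
    intro i j
    have := hτ (t i) (mem_pts t i) (t j) (mem_pts t j)
    rw [hext, hext, Option.some_inj] at this
    rw [← this]
    change _ ↔ t j ∈ (block t τ i).1
    rw [mem_iff_block_eq, eq_comm]
  -- The function of a block is the extremal function at a chosen representative; the choice is
  -- immaterial because `φ` is constant on blocks.
  choose r hr using exists_block_eq t τ
  have hx : ∀ i, φ (r (block t τ i)) = φ i := fun i => (hiff _ _).1 (hr _)
  have hconf : config t τ (fun L => φ (r L)) = fun i => maxFun M.toMeasure (t i) := by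
    ext i
    rw [config, hx i, heq i]
  refine ⟨fun L => φ (r L), fun L => hone _, ?_, ?_, ?_⟩
  · simpa only [hconf] using hC
  · intro L i hi
    rw [hconf]
    -- An atom equal to the maximum at `t i` is the extremal function there, which would put `t i`
    -- in the block `L`.
    refine lt_of_le_of_ne (hM.le_maxFun (hat _) _) fun h => hi ?_
    have h1 := hsing i (φ (r L)) h.ge
    rw [hone, Measure.dirac_apply' _ (measurableSet_singleton _)] at h1
    have h2 : φ i = φ (r L) := by
      by_contra hn
      rw [indicator_of_notMem (s := {φ (r L)}) hn] at h1
      exact one_ne_zero h1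
    rw [mem_iff_block_eq, (hiff _ _).2 h2, hr]
  · intro i
    simp only [hconf]
    exact (hM.exists_restrict_eq_dirac_iff (measurableSet_extremalSet _ (t i))).1 ⟨_, hφ i⟩

lemma ae_pi_mem_atoms (M : PointMeasure T) {ι : Type*} [Fintype ι] :
    ∀ᵐ x ∂Measure.pi (fun _ : ι => M.toMeasure), ∀ i, x i ∈ atoms M.toMeasure :=
  ae_all_iff.2 fun i => (Measure.tendsto_eval_ae_ae (μ := fun _ : ι => M.toMeasure)
    (i := i)).eventually M.isPointMeasure.ae_mem_atoms

open Classical in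
/-- If the extremal functions exist, then there is exactly one tuple of atoms in `scenarioSet` on
the event that the hitting scenario is `τ` and the maximum belongs to `C`, and none otherwise. -/
lemma lintegral_scenarioSet {C : Set (Fin k → ℝ)} {M : PointMeasure T}
    (hex : ∀ i, ∃ f, M.toMeasure.restrict (extremalSet M.toMeasure (t i)) = Measure.dirac f) :
    ∫⁻ x, (scenarioSet t τ C).indicator 1 (M, x) ∂Measure.pi (fun _ => M.toMeasure) =
      if (fun i => maxFun M.toMeasure (t i)) ∈ C ∧ hittingScenario (pts t) M.toMeasure = τ
      then 1 else 0 := by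
  split_ifs with h
  · choose φ hφ using hex
    obtain ⟨x, hx, hxS⟩ := mem_scenarioSet_of_extremal hφ h.2 h.1
    have hxat : ∀ L, x L ∈ atoms M.toMeasure := fun L => by
      change M.toMeasure {x L} ≠ 0
      rw [hx L]
      exact one_ne_zero
    have hae : (fun z => (scenarioSet t τ C).indicator (1 : PointMeasure T × (τ.parts → C0 T) → ℝ≥0∞) (M, z))
        =ᵐ[Measure.pi fun _ => M.toMeasure] ({x} : Set (τ.parts → C0 T)).indicator 1 := by
      filter_upwards [ae_pi_mem_atoms M] with z hz
      by_cases hzS : (M, z) ∈ scenarioSet t τ C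
      · have hzx : z = x := by
          ext1 L
          obtain ⟨i, rfl⟩ := exists_block_eq t τ L
          have h1 := (extremal_of_mem_scenarioSet hz hzS).2.1 i
          rw [(extremal_of_mem_scenarioSet hxat hxS).2.1 i] at h1
          exact (Option.some_inj.1 h1).symm
        rw [indicator_of_mem hzS, hzx, indicator_of_mem (mem_singleton x)]
        rfl
      · rw [indicator_of_notMem hzS, indicator_of_notMem]
        rintro rfl
        exact hzS hxS
    -- The tuple counts exactly once because each of its entries is an atom of multiplicity one.
    rw [lintegral_congr_ae hae, lintegral_indicator_one (measurableSet_singleton x),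
      Measure.pi_singleton]
    simp [hx]
  · have hae : (fun z => (scenarioSet t τ C).indicator (1 : PointMeasure T × (τ.parts → C0 T) → ℝ≥0∞) (M, z))
        =ᵐ[Measure.pi fun _ => M.toMeasure] 0 := by
      filter_upwards [ae_pi_mem_atoms M] with z hz
      refine indicator_of_notMem (fun hzS => h ?_) _
      have h1 := extremal_of_mem_scenarioSet hz hzS
      refine ⟨?_, h1.2.2⟩
      have : (fun i => maxFun M.toMeasure (t i)) = config t τ z := funext h1.1
      rw [this]
      exact hzS.1
    rw [lintegral_congr_ae hae]
    simp

-- By compatibility, exactly one of the added functions reaches `y_i` at `t i`, namely that of its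
-- own block. Each count thus rises by one, and it equals one only if `M` contributed nothing.
variable {t τ} in
lemma addDiracs_mem_scenarioSet_iff {C : Set (Fin k → ℝ)} {M : PointMeasure T}
    {x : τ.parts → C0 T} : (M.addDiracs x, x) ∈ scenarioSet t τ C ↔
      (config t τ x ∈ C ∧ Compatible t τ x) ∧
        M.toMeasure {f | ¬ ∀ i, f (t i) < config t τ x i} = 0 := by
  rw [and_assoc]
  refine and_congr_right fun _ => and_congr_right fun hcomp => ?_
  have hm : ∀ i, MeasurableSet {f : C0 T | config t τ x i ≤ f (t i)} := fun i =>
    measurableSet_le measurable_const (C0.measurable_eval (t i))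
  have hcount : ∀ i, (M.addDiracs x).toMeasure {f | config t τ x i ≤ f (t i)} =
      M.toMeasure {f | config t τ x i ≤ f (t i)} + 1 := by
    intro i
    rw [PointMeasure.toMeasure_addDiracs, Measure.add_apply, Measure.coe_finsetSum,
      Finset.sum_apply, Finset.sum_eq_single (block t τ i)]
    · congr 1
      have hmem : x (block t τ i) ∈ {f : C0 T | config t τ x i ≤ f (t i)} :=
        le_refl (x (block t τ i) (t i))
      rw [Measure.dirac_apply' _ (hm i), indicator_of_mem hmem, Pi.one_apply]
    · intro L _ hL
      rw [Measure.dirac_apply' _ (hm i)]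
      refine indicator_of_notMem (fun h => ?_) _
      exact absurd (hcomp L i fun hi => hL ((mem_iff_block_eq t τ).1 hi).symm) (not_lt.2 h)
    · simp
  have hunion : {f : C0 T | ¬ ∀ i, f (t i) < config t τ x i} =
      ⋃ i, {f | config t τ x i ≤ f (t i)} := by
    ext f
    simp
  rw [hunion, measure_iUnion_null_iff]
  refine forall_congr' fun i => ?_
  simp only [hcount]
  constructor
  · intro h
    have h1 : M.toMeasure {f | config t τ x i ≤ f (t i)} + 1 = 0 + 1 := by rw [h, zero_add]
    exact (ENNReal.add_left_inj ENNReal.one_ne_top).1 h1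
  · intro h
    rw [h, zero_add]

end Configuration

lemma measurableSet_not_forall_lt (t : Fin k → T) (y : Fin k → ℝ) :
    MeasurableSet {f : C0 T | ¬ ∀ i, f (t i) < y i} := by
  have : {f : C0 T | ¬ ∀ i, f (t i) < y i} = ⋃ i, {f | y i ≤ f (t i)} := by
    ext f
    simp
  rw [this]
  exact MeasurableSet.iUnion fun i => measurableSet_le measurable_const (C0.measurable_eval (t i))

/-- The law of the maximum on a hitting scenario, as an integral over the extremal functions. -/
theorem IsPoissonRandomMeasure.scenarioLaw_apply (hΦ : IsPoissonRandomMeasure Pr Φ μ)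
    {η : Ω → T → ℝ} (hη : ∀ ω, η ω = maxFun (Φ ω).toMeasure) (hA : AssumptionA μ (pts t))
    (hηm : Measurable fun ω i => η ω (t i)) (τ : Finpartition (pts t)) {C : Set (Fin k → ℝ)}
    (hC : MeasurableSet C) :
    scenarioLaw Pr Φ η t τ C = ∫⁻ x, {x | config t τ x ∈ C ∧ Compatible t τ x}.indicator
      (fun x => EReal.exp (-(tail μ t (config t τ x) : EReal))) x ∂Measure.pi (fun _ => μ) := by
  classical
  have hτ : MeasurableSet {ω | hittingScenario (pts t) (Φ ω).1 = τ} :=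
    hΦ.measurable (measurableSet_hittingScenario_eq τ)
  have hF : Measurable ((scenarioSet t τ C).indicator
      (1 : PointMeasure T × (τ.parts → C0 T) → ℝ≥0∞)) :=
    measurable_one.indicator (measurableSet_scenarioSet t τ hC)
  have key := hΦ.lintegral_mecke_pi hF
    (fun M x hx => indicator_of_notMem (fun h => hx h.2.1.injective) _)
  have hleft : ∫⁻ ω, ∫⁻ x, (scenarioSet t τ C).indicator 1 (Φ ω, x)
      ∂Measure.pi (fun _ => (Φ ω).toMeasure) ∂Pr = scenarioLaw Pr Φ η t τ C := by
    rw [scenarioLaw, Measure.map_apply hηm hC, Measure.restrict_apply (hηm hC),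
      ← lintegral_indicator_one ((hηm hC).inter hτ)]
    refine lintegral_congr_ae ?_
    have hex : ∀ i, ∀ᵐ ω ∂Pr, ∃ f, (Φ ω).toMeasure.restrict
        (extremalSet (Φ ω).toMeasure (t i)) = Measure.dirac f := fun i =>
      hΦ.ae_extremal_exists (hA _ (mem_pts t i)).1 (hA _ (mem_pts t i)).2
    filter_upwards [ae_all_iff.2 hex] with ω hω
    rw [lintegral_scenarioSet t τ hω, indicator_apply]
    congr 1
    refine propext (and_congr ?_ Iff.rfl)
    change _ ↔ (fun i => η ω (t i)) ∈ C
    rw [hη ω]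
  rw [← hleft, key]
  congr 1
  ext x
  by_cases hx : config t τ x ∈ C ∧ Compatible t τ x
  · have hm0 : MeasurableSet {ω | (Φ ω).toMeasure {f | ¬ ∀ i, f (t i) < config t τ x i} = 0} :=
      hΦ.measurable_count (measurableSet_not_forall_lt t _) (measurableSet_singleton 0)
    -- For a fixed admissible tuple the remaining event is a void event, whose probability is the
    -- exponential weight.
    rw [indicator_of_mem (show x ∈ {x | config t τ x ∈ C ∧ Compatible t τ x} from hx), tail,
      ← hΦ.measure_count_eq_zero (measurableSet_not_forall_lt t _),
      ← lintegral_indicator_one hm0]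
    congr 1
    ext ω
    rw [indicator_apply, indicator_apply, addDiracs_mem_scenarioSet_iff]
    simp only [hx, true_and]
    rfl
  · rw [indicator_of_notMem (show x ∉ {x | config t τ x ∈ C ∧ Compatible t τ x} from hx)]
    have : ∀ ω, (scenarioSet t τ C).indicator (1 : PointMeasure T × (τ.parts → C0 T) → ℝ≥0∞)
        ((Φ ω).addDiracs x, x) = 0 :=
      fun ω => indicator_of_notMem (fun h => hx (addDiracs_mem_scenarioSet_iff.1 h).1) _
    simp [this]

end MaxID

end

/-! ### Product kernels, disintegration and regular versions -/

noncomputable section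

set_option linter.unusedSectionVars false

section PiKernel

lemma lintegral_fin_prod_eq_prod {n : ℕ} {E : Fin n → Type*} [∀ i, MeasurableSpace (E i)]
    (ν : ∀ i, Measure (E i)) [∀ i, SigmaFinite (ν i)] {f : ∀ i, E i → ℝ≥0∞}
    (hf : ∀ i, Measurable (f i)) :
    ∫⁻ x, ∏ i, f i (x i) ∂Measure.pi ν = ∏ i, ∫⁻ x, f i x ∂ν i := by
  induction n with
  | zero =>
    rw [Measure.pi_of_empty ν]
    simp
  | succ n ih =>
    have h := (measurePreserving_piFinSuccAbove ν 0).symm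
    have hm : Measurable fun x : ∀ i, E i => ∏ i, f i (x i) :=
      Finset.measurable_fun_prod _ fun i _ => (hf i).comp (measurable_pi_apply i)
    have e : ∀ p : E 0 × (∀ i : Fin n, E (Fin.succ i)),
        ∏ i, f i ((MeasurableEquiv.piFinSuccAbove E 0).symm p i) =
        f 0 p.1 * ∏ i : Fin n, f i.succ (p.2 i) := by
      intro p
      rw [Fin.prod_univ_succ]
      rfl
    have hmt : Measurable fun x : ∀ i : Fin n, E (Fin.succ i) => ∏ i : Fin n, f i.succ (x i) :=
      Finset.measurable_fun_prod _ fun i _ => (hf i.succ).comp (measurable_pi_apply i)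
    calc ∫⁻ x, ∏ i, f i (x i) ∂Measure.pi ν
        = ∫⁻ p : E 0 × (∀ i : Fin n, E (Fin.succ i)), f 0 p.1 * ∏ i : Fin n, f i.succ (p.2 i)
            ∂(ν 0).prod (Measure.pi fun i : Fin n => ν i.succ) := by
          rw [← h.lintegral_comp hm]
          exact lintegral_congr e
      _ = (∫⁻ x, f 0 x ∂ν 0) * ∏ i : Fin n, ∫⁻ x, f i.succ x ∂ν i.succ := by
          rw [← ih (fun i => ν i.succ) (fun i => hf i.succ)]
          exact lintegral_prod_mul (hf 0).aemeasurable hmt.aemeasurable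
      _ = ∏ i, ∫⁻ x, f i x ∂ν i := by rw [Fin.prod_univ_succ]

variable {ι : Type*} [Fintype ι] {X Y : ι → Type*} [∀ i, MeasurableSpace (X i)]
  [∀ i, MeasurableSpace (Y i)]

lemma lintegral_fintype_prod_eq_prod (ν : ∀ i, Measure (X i)) [∀ i, SigmaFinite (ν i)]
    {f : ∀ i, X i → ℝ≥0∞} (hf : ∀ i, Measurable (f i)) :
    ∫⁻ x, ∏ i, f i (x i) ∂Measure.pi ν = ∏ i, ∫⁻ x, f i x ∂ν i := by
  let e := (Fintype.equivFin ι).symm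
  have hm : Measurable fun x : ∀ i, X i => ∏ i, f i (x i) :=
    Finset.measurable_fun_prod _ fun i _ => (hf i).comp (measurable_pi_apply i)
  rw [← (measurePreserving_piCongrLeft ν e).lintegral_comp hm]
  simp_rw [← e.prod_comp, MeasurableEquiv.coe_piCongrLeft, Equiv.piCongrLeft_apply_apply]
  exact lintegral_fin_prod_eq_prod (fun i => ν (e i)) fun i => hf (e i)

/-- The product of finitely many finite kernels. -/
def ProbabilityTheory.Kernel.piFinite (κ : ∀ i, Kernel (X i) (Y i)) [∀ i, IsFiniteKernel (κ i)] :
    Kernel (∀ i, X i) (∀ i, Y i) where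
  toFun z := Measure.pi fun i => κ i (z i)
  measurable' := by
    refine Measurable.measure_of_isPiSystem generateFrom_pi.symm isPiSystem_pi ?_ ?_
    · rintro _ ⟨s, hs, rfl⟩
      simp only [Measure.pi_pi]
      exact Finset.measurable_fun_prod _ fun i _ =>
        ((κ i).measurable_coe (hs i (mem_univ i))).comp (measurable_pi_apply i)
    · simp only [Measure.pi_univ]
      exact Finset.measurable_fun_prod _ fun i _ =>
        ((κ i).measurable_coe MeasurableSet.univ).comp (measurable_pi_apply i)

lemma ProbabilityTheory.Kernel.piFinite_apply (κ : ∀ i, Kernel (X i) (Y i))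
    [∀ i, IsFiniteKernel (κ i)] (z : ∀ i, X i) :
    Kernel.piFinite κ z = Measure.pi fun i => κ i (z i) := rfl

instance (κ : ∀ i, Kernel (X i) (Y i)) [∀ i, IsFiniteKernel (κ i)] :
    IsFiniteKernel (Kernel.piFinite κ) := by
  refine ⟨⟨∏ i, (κ i).bound, ENNReal.prod_lt_top fun i _ => (κ i).bound_lt_top, fun z => ?_⟩⟩
  rw [Kernel.piFinite_apply, Measure.pi_univ]
  exact Finset.prod_le_prod' fun i _ => Kernel.measure_le_bound (κ i) (z i) univ

/-- Integration against a product of disintegrated measures. -/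
lemma lintegral_pi_compProd (ν : ∀ i, Measure (X i)) [∀ i, SigmaFinite (ν i)]
    (κ : ∀ i, Kernel (X i) (Y i)) [∀ i, IsFiniteKernel (κ i)]
    [∀ i, SigmaFinite (ν i ⊗ₘ κ i)] {G : (∀ i, X i) × (∀ i, Y i) → ℝ≥0∞} (hG : Measurable G) :
    ∫⁻ p, G (fun i => (p i).1, fun i => (p i).2) ∂Measure.pi (fun i => ν i ⊗ₘ κ i) =
      ∫⁻ z, ∫⁻ x, G (z, x) ∂Measure.pi (fun i => κ i (z i)) ∂Measure.pi ν := by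
  have hm : Measurable fun (p : (∀ i, X i) × (∀ i, Y i)) (i : ι) => (p.1 i, p.2 i) := by fun_prop
  -- A product measure is determined by boxes, and on boxes the kernel side factorises coordinate by
  -- coordinate.
  have hpi : Measure.pi (fun i => ν i ⊗ₘ κ i) =
      (Measure.pi ν ⊗ₘ Kernel.piFinite κ).map fun p i => (p.1 i, p.2 i) := by
    refine Measure.pi_eq fun s hs => ?_
    have hs' : MeasurableSet (univ.pi s) := MeasurableSet.univ_pi hs
    rw [Measure.map_apply hm hs', Measure.compProd_apply (hm hs')]
    simp only [Measure.compProd_apply (hs _)]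
    rw [← lintegral_fintype_prod_eq_prod ν fun i => Kernel.measurable_kernel_prodMk_left (hs i)]
    refine lintegral_congr fun z => ?_
    rw [Kernel.piFinite_apply, ← Measure.pi_pi]
    congr 1
  rw [hpi, lintegral_map (by fun_prop) hm, Measure.lintegral_compProd hG]
  rfl

end PiKernel

/-- Disintegration of a `σ`-finite measure on a product with `σ`-finite first marginal. -/
lemma MeasureTheory.Measure.exists_kernel_compProd {X Y : Type*} [MeasurableSpace X]
    [MeasurableSpace Y] [StandardBorelSpace Y] [Nonempty Y] (ρ : Measure (X × Y))
    [SigmaFinite ρ.fst] : ∃ κ : Kernel X Y, IsMarkovKernel κ ∧ ∀ F : X × Y → ℝ≥0∞, Measurable F →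
      ∫⁻ p, F p ∂ρ = ∫⁻ x, ∫⁻ y, F (x, y) ∂κ x ∂ρ.fst := by
  -- A positive integrable weight makes the measure finite, so that a conditional kernel exists. It
  -- depends on the first coordinate only, hence cancels outside the kernel integral.
  obtain ⟨w, hw0, hw, hw1⟩ := exists_pos_lintegral_lt_of_sigmaFinite ρ.fst (ε := 1) one_ne_zero
  have hwm : Measurable fun x => (w x : ℝ≥0∞) := hw.coe_nnreal_ennreal
  let ρ' : Measure (X × Y) := ρ.withDensity fun p => w p.1
  have hfin : IsFiniteMeasure ρ' := by
    refine isFiniteMeasure_withDensity (ne_of_lt ?_)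
    rw [Measure.fst, lintegral_map hwm measurable_fst] at hw1
    exact hw1.trans ENNReal.one_lt_top
  have hfst : ρ'.fst = ρ.fst.withDensity fun x => w x := by
    ext A hA
    rw [Measure.fst_apply hA, withDensity_apply _ (measurable_fst hA), withDensity_apply _ hA,
      Measure.fst, setLIntegral_map hA hwm measurable_fst]
  refine ⟨ρ'.condKernel, inferInstance, fun F hF => ?_⟩
  have hF' : Measurable fun p : X × Y => (w p.1 : ℝ≥0∞)⁻¹ * F p :=
    ((hwm.comp measurable_fst).inv).mul hF
  have hcancel : ∀ x (a : ℝ≥0∞), (w x : ℝ≥0∞) * ((w x : ℝ≥0∞)⁻¹ * a) = a := fun x a => by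
    rw [← mul_assoc, ENNReal.mul_inv_cancel (ENNReal.coe_pos.2 (hw0 x)).ne' ENNReal.coe_ne_top,
      one_mul]
  have h1 : ∫⁻ p, (w p.1 : ℝ≥0∞)⁻¹ * F p ∂ρ' = ∫⁻ p, F p ∂ρ := by
    rw [lintegral_withDensity_eq_lintegral_mul (f := fun p : X × Y => (w p.1 : ℝ≥0∞)) ρ
      (hwm.comp measurable_fst) hF']
    exact lintegral_congr fun p => hcancel p.1 (F p)
  have h2 : ∫⁻ p, (w p.1 : ℝ≥0∞)⁻¹ * F p ∂ρ' = ∫⁻ x, ∫⁻ y, F (x, y) ∂ρ'.condKernel x ∂ρ.fst := by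
    conv_lhs => rw [← ρ'.disintegrate ρ'.condKernel]
    rw [Measure.lintegral_compProd hF', hfst, lintegral_withDensity_eq_lintegral_mul _ hwm
      hF'.lintegral_kernel_prod_right']
    refine lintegral_congr fun x => ?_
    simp only [Pi.mul_apply]
    rw [lintegral_const_mul (f := fun y => F (x, y)) _ (hF.comp measurable_prodMk_left), hcancel]
  rw [← h1, h2]

namespace MaxID

universe u

variable {T : Type u} [MetricSpace T] [CompactSpace T] {μ : Measure (C0 T)}

section RegularVersion

variable {ι : Type} {s : ι → T}

lemma measurableSet_evalAt_ne_zero [Finite ι] (s : ι → T) :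
    MeasurableSet (evalAt (T := T) s ⁻¹' {0}ᶜ) :=
  measurable_evalAt s (measurableSet_singleton _).compl

/-- The image of `μ` under `f ↦ (f(s), f)`, on the set where `f(s) ≠ 0`. -/
def graphMeasure (μ : Measure (C0 T)) (s : ι → T) : Measure ((ι → ℝ) × C0 T) :=
  (μ.restrict (evalAt s ⁻¹' {0}ᶜ)).map fun f => (evalAt s f, f)

lemma measurable_graph (s : ι → T) : Measurable fun f : C0 T => (evalAt s f, f) :=
  (measurable_evalAt s).prodMk measurable_id

lemma fst_graphMeasure [Finite ι] (s : ι → T) : (graphMeasure μ s).fst = marginal μ s := by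
  rw [graphMeasure, Measure.fst, Measure.map_map measurable_fst (measurable_graph s), marginal,
    Measure.restrict_map (measurable_evalAt s) (measurableSet_singleton _).compl]
  rfl

/-- Its second marginal is a restriction of `μ`. -/
lemma sigmaFinite_graphMeasure [SigmaFinite μ] (s : ι → T) : SigmaFinite (graphMeasure μ s) := by
  refine SigmaFinite.of_map _ measurable_snd.aemeasurable ?_
  rw [graphMeasure, Measure.map_map measurable_snd (measurable_graph s)]
  change SigmaFinite (Measure.map id _)
  rw [Measure.map_id]
  infer_instance

lemma lintegral_graphMeasure [Finite ι] (s : ι → T) {F : (ι → ℝ) × C0 T → ℝ≥0∞} (hF : Measurable F)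
    (h0 : ∀ f, F (0, f) = 0) : ∫⁻ p, F p ∂graphMeasure μ s = ∫⁻ f, F (evalAt s f, f) ∂μ := by
  rw [graphMeasure, lintegral_map hF (measurable_graph s),
    ← lintegral_indicator (measurableSet_evalAt_ne_zero s)]
  refine lintegral_congr fun f => ?_
  by_cases hf : evalAt s f = 0
  · rw [indicator_of_notMem (show f ∉ evalAt s ⁻¹' {0}ᶜ from fun h => h hf), hf, h0]
  · rw [indicator_of_mem (show f ∈ evalAt s ⁻¹' {0}ᶜ from hf)]

theorem exists_isRegularVersion [Fintype ι] (hμ : FiniteAway μ) (s : ι → T) :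
    ∃ P, IsRegularVersion μ s P := by
  have hσ := hμ.sigmaFinite_marginal s
  rcases isEmpty_or_nonempty ι with hι | ⟨⟨i⟩⟩
  -- Without coordinates the only vector is `0`, where `F` vanishes, so the null kernel works, even
  -- if `ℂ₀` is empty.
  · have h0 : ∀ x : ι → ℝ, x = 0 := fun x => Subsingleton.elim _ _
    refine ⟨0, fun x _ hx => absurd (h0 x) hx, fun F hF hF0 => ?_⟩
    have : ∀ f, F (evalAt s f, f) = 0 := fun f => by rw [h0 (evalAt s f), hF0]
    simp [this]
  · have : Nonempty (C0 T) := ⟨⟨1, fun _ => zero_le_one, fun h => by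
      have := congrArg (fun f : C(T, ℝ) => f (s i)) h
      simp at this⟩⟩
    have : SigmaFinite (graphMeasure μ s).fst := by rwa [fst_graphMeasure]
    obtain ⟨κ, hκ, h⟩ := (graphMeasure μ s).exists_kernel_compProd
    refine ⟨κ, fun x _ _ => inferInstance, fun F hF hF0 => ?_⟩
    rw [← lintegral_graphMeasure s hF hF0, h F hF, fst_graphMeasure]

lemma ae_marginal_nonneg_ne_zero [Fintype ι] (s : ι → T) :
    ∀ᵐ x ∂marginal μ s, (∀ i, 0 ≤ x i) ∧ x ≠ 0 := by
  have hm : MeasurableSet {x : ι → ℝ | ∀ i, 0 ≤ x i} := by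
    have : {x : ι → ℝ | ∀ i, 0 ≤ x i} = ⋂ i, {x | 0 ≤ x i} := by
      ext x
      simp
    rw [this]
    exact MeasurableSet.iInter fun i => measurableSet_le measurable_const (measurable_pi_apply i)
  rw [marginal]
  refine ((ae_restrict_of_ae ?_).and (ae_restrict_mem (measurableSet_singleton _).compl))
  rw [ae_map_iff (measurable_evalAt s).aemeasurable hm]
  exact Eventually.of_forall fun f i => f.nonneg (s i)

open Classical in
/-- A regular version agrees almost everywhere with a finite kernel that disintegrates
`graphMeasure`. -/
lemma IsRegularVersion.exists_finiteKernel [Fintype ι] (hμ : FiniteAway μ)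
    {P : Kernel (ι → ℝ) (C0 T)} (hP : IsRegularVersion μ s P) :
    ∃ κ : Kernel (ι → ℝ) (C0 T), IsFiniteKernel κ ∧ (∀ᵐ x ∂marginal μ s, P x = κ x) ∧
      graphMeasure μ s = marginal μ s ⊗ₘ κ := by
  have hσ := hμ.sigmaFinite_marginal s
  let S : Set (ι → ℝ) := {x | (∀ i, 0 ≤ x i) ∧ x ≠ 0}
  have hS : MeasurableSet S := by
    have : S = (⋂ i, {x | 0 ≤ x i}) ∩ {0}ᶜ := by
      ext x
      simp [S]
    rw [this]
    exact (MeasurableSet.iInter fun i =>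
      measurableSet_le measurable_const (measurable_pi_apply i)).inter
      (measurableSet_singleton _).compl
  -- The values of `P` outside `S` are unconstrained; setting them to zero yields a finite kernel
  -- and changes nothing almost everywhere.
  let κ : Kernel (ι → ℝ) (C0 T) := Kernel.piecewise hS P 0
  have hae : ∀ᵐ x ∂marginal μ s, P x = κ x := by
    filter_upwards [ae_marginal_nonneg_ne_zero (μ := μ) s] with x hx
    rw [Kernel.piecewise_apply, if_pos (show x ∈ S from hx)]
  have hfin : IsFiniteKernel κ := by
    refine ⟨⟨1, ENNReal.one_lt_top, fun x => ?_⟩⟩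
    rw [Kernel.piecewise_apply]
    split_ifs with hx
    · have := hP.isProbabilityMeasure x hx.1 hx.2
      exact prob_le_one
    · simp
  refine ⟨κ, hfin, hae, ?_⟩
  ext E hE
  -- The defining identity only tests functions vanishing over `0`.
  let E' : Set ((ι → ℝ) × C0 T) := E ∩ {p | p.1 ≠ 0}
  have hne : MeasurableSet {p : (ι → ℝ) × C0 T | p.1 ≠ 0} :=
    measurable_fst (measurableSet_singleton (0 : ι → ℝ)).compl
  have hE' : MeasurableSet E' := hE.inter hne
  have hF : Measurable (E'.indicator (1 : (ι → ℝ) × C0 T → ℝ≥0∞)) := measurable_one.indicator hE'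
  have hF0 : ∀ f, E'.indicator (1 : (ι → ℝ) × C0 T → ℝ≥0∞) (0, f) = 0 := fun f =>
    indicator_of_notMem (fun h => h.2 rfl) _
  have h1 : graphMeasure μ s E = graphMeasure μ s E' := by
    refine measure_congr ?_
    have hmem : ∀ᵐ p ∂graphMeasure μ s, p.1 ≠ 0 := by
      rw [graphMeasure, ae_map_iff (measurable_graph s).aemeasurable hne]
      exact ae_restrict_mem (measurableSet_evalAt_ne_zero s)
    filter_upwards [hmem] with p hp
    exact propext ⟨fun h => ⟨h, hp⟩, fun h => h.1⟩
  rw [h1, ← lintegral_indicator_one hE', lintegral_graphMeasure s hF hF0, hP.lintegral_eq _ hF hF0,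
    Measure.compProd_apply hE]
  refine lintegral_congr_ae ?_
  filter_upwards [hae, ae_marginal_nonneg_ne_zero (μ := μ) s] with x hx hx0
  rw [hx, ← lintegral_indicator_one (measurable_prodMk_left hE)]
  refine lintegral_congr fun f => ?_
  by_cases h : (x, f) ∈ E
  · rw [indicator_of_mem (show (x, f) ∈ E' from ⟨h, hx0.2⟩),
      indicator_of_mem (show f ∈ Prod.mk x ⁻¹' E from h)]
    rfl
  · rw [indicator_of_notMem (fun h' => h h'.1),
      indicator_of_notMem (show f ∉ Prod.mk x ⁻¹' E from h)]

end RegularVersion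

end MaxID

end

/-! ### The explicit law as an integral over tuples of functions -/

noncomputable section

set_option linter.unusedSectionVars false

namespace MaxID

universe u

variable {T : Type u} [MetricSpace T] [CompactSpace T] [DecidableEq T] {μ : Measure (C0 T)}
  {k : ℕ} {t : Fin k → T}

/-- Every non-negative `f` violates `f (t i) < y i`, and the total mass is infinite by (A). So the
weight `exp(-μ̄_t(y))` ignores non-positive coordinates. -/
lemma tail_eq_top (hA : AssumptionA μ (pts t)) {y : Fin k → ℝ} {i : Fin k} (hi : y i ≤ 0) :
    tail μ t y = ∞ := by
  refine top_le_iff.1 ((measure_pos_eq_top (hA _ (mem_pts t i)).2).symm.le.trans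
    (measure_mono fun f hf => ?_))
  exact fun h => absurd (h i) (not_lt.2 (hi.trans (f.nonneg (t i))))

lemma measurable_exp_neg_tail [SigmaFinite μ] (t : Fin k → T) :
    Measurable fun y : Fin k → ℝ => EReal.exp (-(tail μ t y : EReal)) := by
  have hS : MeasurableSet {p : (Fin k → ℝ) × C0 T | ¬ ∀ i, p.2 (t i) < p.1 i} := by
    have : {p : (Fin k → ℝ) × C0 T | ¬ ∀ i, p.2 (t i) < p.1 i} =
        ⋃ i, {p | p.1 i ≤ p.2 (t i)} := by
      ext p
      simp
    rw [this]
    exact MeasurableSet.iUnion fun i => measurableSet_le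
      ((measurable_pi_apply i).comp measurable_fst) ((C0.measurable_eval (t i)).comp measurable_snd)
  have h : Measurable fun y : Fin k → ℝ => tail μ t y := measurable_measure_prodMk_left hS
  exact EReal.measurable_exp.comp h.coe_ereal_ennreal.neg

lemma measurable_glue (τ : Finpartition (pts t)) : Measurable (glue t τ) :=
  measurable_pi_lambda _ fun _ => (measurable_pi_apply _).comp (measurable_pi_apply _)

lemma subVec_glue (τ : Finpartition (pts t)) (z : ∀ L : τ.parts, Idx t L.1 → ℝ) (L : τ.parts) :
    subVec t L.1 (glue t τ z) = z L := by
  ext ⟨i, hi⟩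
  have h : block t τ i = L := (mem_iff_block_eq t τ).1 hi
  subst h
  rfl

lemma measurable_subVec (L : Finset T) : Measurable (subVec t L) :=
  measurable_pi_lambda _ fun i => measurable_pi_apply i.1

/-- Allows a kernel to be modified on a null set of one block marginal without changing the density
almost everywhere. -/
lemma quasiMeasurePreserving_subVec (hμ : FiniteAway μ) (τ : Finpartition (pts t)) (L : τ.parts) :
    Measure.QuasiMeasurePreserving (subVec t L.1) (blockProduct μ t τ)
      (marginal μ (subPoints t L.1)) := by
  have hσ : ∀ L : τ.parts, SigmaFinite (marginal μ (subPoints t L.1)) := fun L =>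
    hμ.sigmaFinite_marginal _
  refine ⟨measurable_subVec _, ?_⟩
  rw [blockProduct, Measure.map_map (measurable_subVec _) (measurable_glue τ)]
  have : subVec t L.1 ∘ glue t τ = Function.eval L := funext fun z => subVec_glue τ z L
  rw [this]
  exact (Measure.quasiMeasurePreserving_eval
    (μ := fun L : τ.parts => marginal μ (subPoints t L.1)) L).absolutelyContinuous

lemma measurableSet_forall_lt (t : Fin k → T) (L : Finset T) :
    MeasurableSet {p : (Fin k → ℝ) × C0 T | ∀ i, t i ∉ L → p.2 (t i) < p.1 i} := by
  have : {p : (Fin k → ℝ) × C0 T | ∀ i, t i ∉ L → p.2 (t i) < p.1 i} =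
      ⋂ i, {p | t i ∉ L → p.2 (t i) < p.1 i} := by
    ext p
    simp only [mem_iInter]
    rfl
  rw [this]
  refine MeasurableSet.iInter fun i => ?_
  by_cases h : t i ∈ L
  · simp [h]
  · simp only [h, not_false_eq_true, forall_const]
    exact measurableSet_lt ((C0.measurable_eval (t i)).comp measurable_snd)
      ((measurable_pi_apply i).comp measurable_fst)

/-- The explicit law on a hitting scenario, as an integral over the extremal functions. -/
theorem explicitLaw_apply (hμ : FiniteAway μ) (hA : AssumptionA μ (pts t))
    (τ : Finpartition (pts t)) {P : ∀ L : Finset T, Kernel (Idx t L → ℝ) (C0 T)}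
    (hP : ∀ L ∈ τ.parts, IsRegularVersion μ (subPoints t L) (P L)) {C : Set (Fin k → ℝ)}
    (hC : MeasurableSet C) :
    explicitLaw μ t τ P C = ∫⁻ x, {x | config t τ x ∈ C ∧ Compatible t τ x}.indicator
      (fun x => EReal.exp (-(tail μ t (config t τ x) : EReal))) x ∂Measure.pi (fun _ => μ) := by
  have hσμ := hμ.sigmaFinite
  have hσ : ∀ L : τ.parts, SigmaFinite (marginal μ (subPoints t L.1)) := fun L =>
    hμ.sigmaFinite_marginal _
  choose κ hκ hPκ hgraph using fun L : τ.parts => (hP L.1 L.2).exists_finiteKernel hμ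
  let W : (Fin k → ℝ) → ℝ≥0∞ := fun y => EReal.exp (-(tail μ t y : EReal))
  have hW : Measurable W := measurable_exp_neg_tail t
  have hblock : ∀ L : τ.parts, Measurable fun y : Fin k → ℝ =>
      κ L (subVec t L.1 y) {f | ∀ i, t i ∉ L.1 → f (t i) < y i} := fun L =>
    Kernel.measurable_kernel_prodMk_left
      (κ := (κ L).comap (subVec t L.1) (measurable_subVec _)) (measurableSet_forall_lt t L.1)
  have hdens : Measurable fun y => W y * ∏ L : τ.parts,
      κ L (subVec t L.1 y) {f | ∀ i, t i ∉ L.1 → f (t i) < y i} :=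
    hW.mul (Finset.measurable_fun_prod _ fun L _ => hblock L)
  have hlaw : explicitLaw μ t τ P = (blockProduct μ t τ).withDensity fun y => W y *
      ∏ L : τ.parts, κ L (subVec t L.1 y) {f | ∀ i, t i ∉ L.1 → f (t i) < y i} := by
    refine withDensity_congr_ae ?_
    filter_upwards [ae_all_iff.2 fun L : τ.parts =>
      (quasiMeasurePreserving_subVec hμ τ L).ae (hPκ L)] with y hy
    rw [← Finset.prod_coe_sort]
    simp only [hy]
    rfl
  let S : Set ((∀ L : τ.parts, Idx t L.1 → ℝ) × (τ.parts → C0 T)) := {p | glue t τ p.1 ∈ C ∧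
    ∀ L, p.2 L ∈ {f : C0 T | ∀ i, t i ∉ L.1 → f (t i) < glue t τ p.1 i}}
  let G : (∀ L : τ.parts, Idx t L.1 → ℝ) × (τ.parts → C0 T) → ℝ≥0∞ :=
    S.indicator fun p => W (glue t τ p.1)
  have hG : Measurable G := by
    refine (hW.comp ((measurable_glue τ).comp measurable_fst)).indicator ?_
    refine (((measurable_glue τ).comp measurable_fst) hC).inter ?_
    have : {p : (∀ L : τ.parts, Idx t L.1 → ℝ) × (τ.parts → C0 T) |
        ∀ L, p.2 L ∈ {f : C0 T | ∀ i, t i ∉ L.1 → f (t i) < glue t τ p.1 i}} =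
        ⋂ L : τ.parts, (fun p => (glue t τ p.1, p.2 L)) ⁻¹'
          {p : (Fin k → ℝ) × C0 T | ∀ i, t i ∉ L.1 → p.2 (t i) < p.1 i} := by
      ext p
      simp only [mem_iInter]
      rfl
    change MeasurableSet {p : (∀ L : τ.parts, Idx t L.1 → ℝ) × (τ.parts → C0 T) |
        ∀ L, p.2 L ∈ {f : C0 T | ∀ i, t i ∉ L.1 → f (t i) < glue t τ p.1 i}}
    rw [this]
    exact MeasurableSet.iInter fun L => ((measurable_glue τ).comp measurable_fst).prodMk
      ((measurable_pi_apply L).comp measurable_snd) (measurableSet_forall_lt t L.1)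
  -- For fixed `y` the condition on the functions is a box, with one constraint per block, so its
  -- product measure is the product in the density.
  have hinner : ∀ z : ∀ L : τ.parts, Idx t L.1 → ℝ,
      ∫⁻ x, G (z, x) ∂Measure.pi (fun L => κ L (z L)) = C.indicator (fun y => W y *
        ∏ L : τ.parts, κ L (subVec t L.1 y) {f | ∀ i, t i ∉ L.1 → f (t i) < y i}) (glue t τ z) := by
    intro z
    have hD : ∀ L : τ.parts,
        MeasurableSet {f : C0 T | ∀ i, t i ∉ L.1 → f (t i) < glue t τ z i} := fun L =>
      measurable_prodMk_left (x := glue t τ z) (measurableSet_forall_lt t L.1)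
    by_cases hz : glue t τ z ∈ C
    · rw [indicator_of_mem hz]
      simp only [subVec_glue]
      rw [← Measure.pi_pi, ← lintegral_indicator_const (MeasurableSet.univ_pi hD)]
      refine lintegral_congr fun x => ?_
      by_cases hx : ∀ L, x L ∈ {f : C0 T | ∀ i, t i ∉ L.1 → f (t i) < glue t τ z i}
      · rw [indicator_of_mem (mem_univ_pi.2 hx)]
        exact indicator_of_mem (show (z, x) ∈ S from ⟨hz, hx⟩) _
      · rw [indicator_of_notMem (mt mem_univ_pi.1 hx)]
        exact indicator_of_notMem (show (z, x) ∉ S from fun h => hx h.2) _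
    · rw [indicator_of_notMem hz]
      have : ∀ x, G (z, x) = 0 := fun x =>
        indicator_of_notMem (show (z, x) ∉ S from fun h => hz h.1) _
      simp [this]
  have hσ' : ∀ L : τ.parts, SigmaFinite (marginal μ (subPoints t L.1) ⊗ₘ κ L) := fun L => by
    rw [← hgraph L]
    exact sigmaFinite_graphMeasure _
  have hgm : ∀ L : τ.parts, Measurable fun f : C0 T => (evalAt (subPoints t L.1) f, f) := fun L =>
    measurable_graph _
  -- The product of the disintegrated measures is the image of a power of `μ`, restricted to tuples
  -- in which no function vanishes on its own block.
  have hpi : Measure.pi (fun L : τ.parts => marginal μ (subPoints t L.1) ⊗ₘ κ L) =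
      ((Measure.pi fun _ : τ.parts => μ).restrict
        (univ.pi fun L : τ.parts => evalAt (subPoints t L.1) ⁻¹' {0}ᶜ)).map
        fun x L => (evalAt (subPoints t L.1) (x L), x L) := by
    rw [Measure.restrict_pi_pi]
    have hs : ∀ L : τ.parts, SigmaFinite ((μ.restrict
        (evalAt (subPoints t L.1) ⁻¹' {0}ᶜ)).map fun f => (evalAt (subPoints t L.1) f, f)) :=
      fun L => sigmaFinite_graphMeasure _
    rw [Measure.pi_map_pi fun L => (hgm L).aemeasurable]
    congr 1
    ext1 L
    exact (hgraph L).symm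
  have hmap : Measurable fun (x : τ.parts → C0 T) (L : τ.parts) =>
      (evalAt (subPoints t L.1) (x L), x L) :=
    measurable_pi_lambda _ fun L => (hgm L).comp (measurable_pi_apply L)
  rw [hlaw, withDensity_apply _ hC, ← lintegral_indicator hC, blockProduct,
    lintegral_map (hdens.indicator hC) (measurable_glue τ)]
  simp only [← hinner]
  rw [← lintegral_pi_compProd _ _ hG, hpi, lintegral_map (by fun_prop) hmap,
    ← lintegral_indicator (MeasurableSet.univ_pi fun L => measurableSet_evalAt_ne_zero _)]
  refine lintegral_congr fun x => ?_
  have hGx : G (fun L => evalAt (subPoints t L.1) (x L), fun L => x L) =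
      {x | config t τ x ∈ C ∧ Compatible t τ x}.indicator
        (fun x => EReal.exp (-(tail μ t (config t τ x) : EReal))) x := rfl
  by_cases hx : x ∈ univ.pi fun L : τ.parts => evalAt (subPoints t L.1) ⁻¹' ({0}ᶜ : Set (Idx t L.1 → ℝ))
  · rw [indicator_of_mem hx, hGx]
  · rw [indicator_of_notMem hx]
    rw [mem_univ_pi, not_forall] at hx
    obtain ⟨L, hL⟩ := hx
    have hL0 : evalAt (subPoints t L.1) (x L) = 0 := not_not.1 hL
    -- The tuples lost in the restriction have a zero coordinate in `y`, so they carry weight zero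
    -- in the unrestricted integral as well.
    obtain ⟨i, rfl⟩ := exists_block_eq t τ L
    have hi : config t τ x i = 0 := congrFun hL0 ⟨i, mem_block t τ i⟩
    have : EReal.exp (-(tail μ t (config t τ x) : EReal)) = 0 := by
      rw [tail_eq_top hA hi.le]
      simp
    by_cases hc : x ∈ {x | config t τ x ∈ C ∧ Compatible t τ x}
    · rw [indicator_of_mem hc, this]
    · rw [indicator_of_notMem hc]

end MaxID

end

theorem theorem3p1 {T : Type*} [MetricSpace T] [CompactSpace T] [DecidableEq T]
    {Ω : Type*} [MeasurableSpace Ω] (Pr : MeasureTheory.Measure Ω)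
    [MeasureTheory.IsProbabilityMeasure Pr]
    (μ : MeasureTheory.Measure (MaxID.C0 T)) (Φ : Ω → MaxID.PointMeasure T)
    (hΦ : MaxID.IsPoissonRandomMeasure Pr Φ μ)
    (η : Ω → T → ℝ) (hη : ∀ ω, η ω = MaxID.maxFun (Φ ω).1)
    {k : ℕ} (t : Fin k → T) (hA : MaxID.AssumptionA μ (MaxID.pts t)) :
    -- the random vector `η(t)` and the hitting scenario are measurable
    Measurable (fun ω i => η ω (t i)) ∧
    (∀ τ, MeasurableSet {ω | MaxID.hittingScenario (MaxID.pts t) (Φ ω).1 = τ}) ∧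
    -- almost surely, all extremal functions exist, so that the hitting scenario is well defined
    (∀ᵐ ω ∂Pr, ∀ s ∈ MaxID.pts t, ∃ f : MaxID.C0 T,
      MaxID.extremalPart {s} (Φ ω).1 = MeasureTheory.Measure.dirac f) ∧
    -- regular versions of the conditional measures exist
    (∀ L : Finset T, ∃ P, MaxID.IsRegularVersion μ (MaxID.subPoints t L) P) ∧
    -- for every choice of them, the law on each hitting scenario is the explicit one
    (∀ (τ : Finpartition (MaxID.pts t))
        (P : ∀ L : Finset T, ProbabilityTheory.Kernel (MaxID.Idx t L → ℝ) (MaxID.C0 T)),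
      (∀ L ∈ τ.parts, MaxID.IsRegularVersion μ (MaxID.subPoints t L) (P L)) →
      MaxID.scenarioLaw Pr Φ η t τ = MaxID.explicitLaw μ t τ P) ∧
    -- the law of `η(t)` is the sum over all hitting scenarios
    Pr.map (fun ω i => η ω (t i)) =
      ∑ τ : Finpartition (MaxID.pts t), MaxID.scenarioLaw Pr Φ η t τ := by
  have hηm : Measurable (fun ω i => η ω (t i)) := by
    refine measurable_pi_lambda _ fun i => ?_
    simp only [hη]
    exact (MaxID.PointMeasure.measurable_maxFun (t i)).comp hΦ.measurable
  refine ⟨hηm, fun τ => hΦ.measurable (MaxID.measurableSet_hittingScenario_eq τ), ?_,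
    fun L => MaxID.exists_isRegularVersion hΦ.finiteAway _, fun τ P hP => ?_,
    MaxID.map_eq_sum_scenarioLaw hΦ.measurable hηm⟩
  · refine (Finset.eventually_all _).2 fun s hs => ?_
    filter_upwards [hΦ.ae_extremal_exists (hA s hs).1 (hA s hs).2] with ω hω
    obtain ⟨f, hf⟩ := hω
    exact ⟨f, (MaxID.extremalPart_singleton _ s).trans hf⟩
  · ext C hC
    -- Both measures of `C` are the same integral over tuples of functions, one per block.
    rw [hΦ.scenarioLaw_apply hη hA hηm τ hC, MaxID.explicitLaw_apply hΦ.finiteAway hA τ hP hC]
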